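/- **Definitions.** Graphs are finite directed graphs (loops allowed), regarded as structures over the signature $\{E\}$ with one binary relation symbol. A tournament is a loopless directed graph with exactly one of the edges $u\to v$, $v\to u$ for any two distinct vertices $u,v$. *Linear NLC-width.* Let $[k]=\{1,\dots,k\}$. $\mathcal T_k$ is the class of tournaments with a labelling $\lambda:V\to[k]$ that are obtained, up to isomorphism, from the empty tournament by finitely many applications of the following operations: *vertex addition*, given by $X\subseteq[k]$ and $c\in[k]$: add a new vertex $v$ with label $c$ and, for each old vertex $u$, the edge $u\to v$ if $\lambda(u)\in X$ and $v\to u$ otherwise; *relabelling*, given by $\rho:[k]\to[k]$: replace $\lambda$ by $\rho\circ\lambda$. The linear NLC-width of a tournament $T$ is the least $k$ such that $T$, with a suitable labelling, belongs to $\mathcal T_k$. *Cut-rank.* For a linear ordering $x_1<\dots<x_n$ of the vertices of a graph $G=(V,E)$, its cut-rank is the maximum over $i$ of the rank over $\mathbb F_2$ of the $\{x_1,\dots,x_i\}\times\{x_{i+1},\dots,x_n\}$ matrix whose $(x,y)$ entry is $1$ if $(x,y)\in E$ and $0$ otherwise (it is $0$ if $V=\emptyset$). *Transductions.* An FO transduction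 from a finite relational signature $\Gamma$ to a finite relational signature $\Delta$ is a finite sequence of operations with matching signatures, each of which maps a structure $S$ to a set of structures: *interpretation* (keep the universe, define each relation of the new signature by a first-order formula over the old one); *colouring* (add finitely many new unary relations, in all possible ways); *filtering* by a first-order sentence (output $S$ if $S$ satisfies it, nothing otherwise); *universe restriction* (keep only the elements that satisfy a given first-order formula with one free variable); *$k$-copying* (take $k$ disjoint copies of $S$ and add a $k$-ary relation consisting of the tuples of the $k$ copies of an element of $S$). Its outputs on $S$ are the structures obtained by applying the operations in order; write $\Phi(S)$ for the set of outputs. If $\Gamma\subseteq\Delta$, then $\Phi$ is an *extension* transduction if for every $\Gamma$-structure $S$, every $T\in\Phi(S)$ has the same universe as $S$ and the same relation as $S$ for each symbol in $\Gamma$. **Theorem.** There are a computable function that maps each $k\in\mathbb N$ to (a Gödel number of) an extension FO transduction $\Phi_k$ from $\{E\}$ to $\{E,<\}$ (with $E,<$ binary), and a computable function $k\mapsto k'$ from $\mathbb N$ to $\mathbb N$, such that for every $k\in\mathbb N$: 1. for every graph $G=(V,E)$, every structure in $\Phi_k(G)$ is $(V,E,<)$ for some linear ordering $<$ of $V$ whose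 cut-rank in $G$ is at most $k'$; and 2. if $T=(V,E)$ is a tournament of linear NLC-width at most $k$, then $\Phi_k(T)$ contains at least one such structure, i.e. $(V,E,<)\in\Phi_k(T)$ for some linear ordering $<$ of $V$ whose cut-rank in $T$ is at most $k'$. -/

import Mathlib

open scoped FirstOrder

universe u

/-! ### Relational signatures and structures -/

/-- A finite relational signature, given as the list of the arities of its symbols.
The symbols are the positions in the list. -/
abbrev Signature := List ℕ

namespace Signature

/-- The first-order language of a signature: no function symbols, and as relation symbols of arity
`r` the positions of the list that carry the entry `r`. -/
abbrev lang (Γ : Signature) : FirstOrder.Language.{0, 0} where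
  Functions _ := Empty
  Relations r := {i : ℕ // Γ[i]? = some r}

/-- A symbol of `Γ`, as a symbol of a larger signature `Γ ++ Δ`. -/
def incl {Γ : Signature} (Δ : Signature) {r : ℕ} (R : Γ.lang.Relations r) :
    (Γ ++ Δ).lang.Relations r :=
  ⟨R.1, by
    obtain ⟨i, h⟩ := R
    obtain ⟨hi, -⟩ := List.getElem?_eq_some_iff.1 h
    simpa [List.getElem?_append_left hi] using h⟩

/-- The symbol of `Γ` at a given position. -/
def symb (Γ : Signature) (i : Fin Γ.length) : Γ.lang.Relations (Γ[i]) :=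
  ⟨i, by simp⟩

/-- The symbol that is added to `Γ` in the signature `Γ ++ [r]`. -/
def newSymb (Γ : Signature) (r : ℕ) : (Γ ++ [r]).lang.Relations r :=
  ⟨Γ.length, by simp⟩

end Signature

/-- A relational structure over the signature `Γ`: a universe (possibly empty) together with a
relation of the right arity for each symbol. -/
abbrev RelStructure (Γ : Signature) := CategoryTheory.Bundled.{u} Γ.lang.Structure

namespace RelStructure

/-- The structure with universe `V` and with the given relations. -/
def ofRel {Γ : Signature} (V : Type u)
    (rel : ∀ {r : ℕ}, Γ.lang.Relations r → (Fin r → V) → Prop) : RelStructure.{u} Γ :=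
  ⟨V, { funMap := fun f => Empty.elim f, RelMap := rel }⟩

/-- `S.Holds R x`: the tuple `x` belongs to the relation that interprets the symbol `R` in `S`. -/
def Holds {Γ : Signature} (S : RelStructure.{u} Γ) {r : ℕ} (R : Γ.lang.Relations r)
    (x : Fin r → S.α) : Prop :=
  S.str.RelMap R x

/-- `T` is an extension of `S`: it has the same universe, and the same relation for each symbol of
the signature of `S`. -/
def IsExtensionOf {Γ Δ : Signature} (T : RelStructure.{u} (Γ ++ Δ)) (S : RelStructure.{u} Γ) :
    Prop :=
  ∃ str : (Γ ++ Δ).lang.Structure S.α, T = ⟨S.α, str⟩ ∧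
    ∀ {r : ℕ} (R : Γ.lang.Relations r) (x : Fin r → S.α),
      str.RelMap (Signature.incl Δ R) x ↔ S.Holds R x

end RelStructure

/-! ### First-order transductions -/

/-- The elementary operations of first-order transductions, with input and output signature. -/
inductive FOOp : Signature → Signature → Type
  /-- Interpretation, given by a formula over `Γ` for each symbol of `Δ`. -/
  | interpretation {Γ : Signature} (Δ : Signature)
      (φ : ∀ {r : ℕ}, Δ.lang.Relations r → Γ.lang.Formula (Fin r)) : FOOp Γ Δ
  /-- Colouring by `c` new unary symbols. -/
  | colouring {Γ : Signature} (c : ℕ) : FOOp Γ (Γ ++ List.replicate c 1)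
  /-- Filtering by a sentence. -/
  | filtering {Γ : Signature} (φ : Γ.lang.Sentence) : FOOp Γ Γ
  /-- Restriction of the universe by a formula with one free variable. -/
  | restriction {Γ : Signature} (φ : Γ.lang.Formula (Fin 1)) : FOOp Γ Γ
  /-- `k`-copying, with a new symbol of arity `k`. -/
  | copying {Γ : Signature} (k : ℕ) : FOOp Γ (Γ ++ [k])

/-- The set of outputs of an elementary operation on an input structure. -/
def FOOp.outputs : {Γ Δ : Signature} → FOOp Γ Δ → RelStructure.{u} Γ → Set (RelStructure.{u} Δ)
  | _, _, .interpretation _ φ, S =>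
      {RelStructure.ofRel S.α fun R x => (φ R).Realize x}
  | _, _, .colouring _, S => {T | T.IsExtensionOf S}
  | _, _, .filtering φ, S => {T | T = S ∧ S.α ⊨ φ}
  | Γ, _, .restriction φ, S =>
      {RelStructure.ofRel (Γ := Γ) {v : S.α // φ.Realize fun _ => v}
        fun R x => S.Holds R fun i => (x i).1}
  | Γ, _, .copying k, S =>
      {T | ∃ str : (Γ ++ [k]).lang.Structure (S.α × Fin k), T = ⟨S.α × Fin k, str⟩ ∧
        (∀ {r : ℕ} (R : Γ.lang.Relations r) (x : Fin r → S.α × Fin k),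
          str.RelMap (Signature.incl [k] R) x ↔
            ∃ (c : Fin k) (y : Fin r → S.α), S.Holds R y ∧ x = fun i => (y i, c)) ∧
        ∀ x : Fin k → S.α × Fin k,
          str.RelMap (Signature.newSymb Γ k) x ↔ ∃ v : S.α, x = fun c => (v, c)}

/-- A first-order transduction: a finite sequence of elementary operations with matching
signatures. -/
inductive FOTransduction : Signature → Signature → Type
  | nil {Γ : Signature} : FOTransduction Γ Γ
  | cons {Γ Δ Θ : Signature} (a : FOOp Γ Δ) (Φ : FOTransduction Δ Θ) : FOTransduction Γ Θ

/-- The set of outputs of a first-order transduction on an input structure. -/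
def FOTransduction.outputs :
    {Γ Δ : Signature} → FOTransduction Γ Δ → RelStructure.{u} Γ → Set (RelStructure.{u} Δ)
  | _, _, .nil, S => {S}
  | _, _, .cons a Φ, S => ⋃ S' ∈ a.outputs S, Φ.outputs S'

/-- An extension transduction: every output is an extension of the input. -/
def FOTransduction.IsExtension {Γ Δ : Signature} (Φ : FOTransduction Γ (Γ ++ Δ)) : Prop :=
  ∀ S : RelStructure.{u} Γ, ∀ T ∈ Φ.outputs S, T.IsExtensionOf S

/-! ### Gödel numbers of formulas and transductions -/

/-- The number of a term, that is, of a variable; `v` numbers the free variables. -/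
def termCode {Γ : Signature} {α : Type} (v : α → ℕ) {n : ℕ} : Γ.lang.Term (α ⊕ Fin n) → ℕ
  | .var (.inl i) => 2 * v i
  | .var (.inr j) => 2 * j + 1
  | .func f _ => Empty.elim f

/-- The Gödel number of a first-order formula over a signature; `v` numbers the free variables. -/
def formulaCode {Γ : Signature} {α : Type} (v : α → ℕ) : {n : ℕ} → Γ.lang.BoundedFormula α n → ℕ
  | _, .falsum => Nat.pair 0 0
  | _, .equal s t => Nat.pair 1 (Nat.pair (termCode v s) (termCode v t))
  | _, .rel R ts =>
      Nat.pair 2 (Nat.pair R.1 (Encodable.encode (List.ofFn fun i => termCode v (ts i))))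
  | _, .imp φ ψ => Nat.pair 3 (Nat.pair (formulaCode v φ) (formulaCode v ψ))
  | _, .all φ => Nat.pair 4 (formulaCode v φ)

/-- The Gödel number of an elementary operation with a known input signature. -/
def FOOp.code : {Γ Δ : Signature} → FOOp Γ Δ → ℕ
  | _, _, .interpretation Δ φ =>
      Nat.pair 0 (Nat.pair (Encodable.encode Δ)
        (Encodable.encode
          (List.ofFn fun i : Fin Δ.length => formulaCode Fin.val (φ (Δ.symb i)))))
  | _, _, .colouring c => Nat.pair 1 c
  | _, _, .filtering φ => Nat.pair 2 (formulaCode Empty.elim φ)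
  | _, _, .restriction φ => Nat.pair 3 (formulaCode Fin.val φ)
  | _, _, .copying k => Nat.pair 4 k

/-- The Gödel number of a transduction with a known input signature. -/
def FOTransduction.code : {Γ Δ : Signature} → FOTransduction Γ Δ → ℕ
  | _, _, .nil => 0
  | _, _, .cons a Φ => Nat.pair a.code Φ.code + 1

theorem termCode_injective {Γ : Signature} {α : Type} {v : α → ℕ} (hv : v.Injective) {n : ℕ} :
    (termCode (Γ := Γ) (n := n) v).Injective := by
  rintro (⟨i | i⟩ | ⟨f, _⟩) (⟨j | j⟩ | ⟨g, _⟩) h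
  · simp only [termCode] at h
    rw [hv (by omega : v i = v j)]
  · simp only [termCode] at h; omega
  · exact Empty.elim g
  · simp only [termCode] at h; omega
  · simp only [termCode] at h
    rw [Fin.ext (by omega : i.1 = j.1)]
  · exact Empty.elim g
  all_goals exact Empty.elim f

theorem formulaCode_injective {Γ : Signature} {α : Type} {v : α → ℕ} (hv : v.Injective) {n : ℕ} :
    (formulaCode (Γ := Γ) (n := n) v).Injective := by
  intro φ
  induction φ with
  | falsum => rintro (_ | _ | _ | _ | _) h <;> simp_all [formulaCode]
  | equal s t =>
    rintro (_ | ⟨s', t'⟩ | _ | _ | _) h <;> simp [formulaCode] at h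
    rw [termCode_injective hv h.1, termCode_injective hv h.2]
  | @rel n l R ts =>
    rintro (_ | _ | @⟨_, l', R', ts'⟩ | _ | _) h <;> simp [formulaCode] at h
    obtain ⟨R, hR⟩ := R
    obtain ⟨R', hR'⟩ := R'
    obtain ⟨h1, h2⟩ := h
    simp only at h1
    subst h1
    obtain rfl : l = l' := Option.some.inj (hR.symm.trans hR')
    have h3 := List.ofFn_injective h2
    obtain rfl : ts = ts' := funext fun i => termCode_injective hv (congrFun h3 i)
    rfl
  | imp φ ψ ih₁ ih₂ =>
    rintro (_ | _ | _ | ⟨φ', ψ'⟩ | _) h <;> simp [formulaCode] at h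
    rw [ih₁ h.1, ih₂ h.2]
  | all φ ih =>
    rintro (_ | _ | _ | _ | φ') h <;> simp [formulaCode] at h
    rw [ih h]

theorem FOOp.code_injective {Γ : Signature} :
    (fun a : Σ Δ, FOOp Γ Δ => a.2.code).Injective := by
  rintro ⟨Δ, a⟩ ⟨Δ', b⟩ h
  cases a <;> cases b <;> simp [FOOp.code] at h
  case interpretation.interpretation φ ψ =>
    obtain ⟨rfl, h⟩ := h
    have h' : ∀ (r : ℕ) (R : Δ.lang.Relations r), φ R = ψ R := by
      rintro r ⟨i, hi⟩
      obtain ⟨hl, rfl⟩ := List.getElem?_eq_some_iff.1 hi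
      exact formulaCode_injective Fin.val_injective
        (congrFun (List.ofFn_injective h) (Fin.mk i hl))
    obtain rfl : @φ = @ψ := by
      funext r R
      exact h' r R
    rfl
  case colouring.colouring => subst h; rfl
  case filtering.filtering => rw [formulaCode_injective (fun x => x.elim) h]
  case restriction.restriction => rw [formulaCode_injective Fin.val_injective h]
  case copying.copying => subst h; rfl

/-- Distinct transductions with the same input signature have distinct Gödel numbers. -/
theorem FOTransduction.code_injective {Γ : Signature} :
    (fun Φ : Σ Δ, FOTransduction Γ Δ => Φ.2.code).Injective := by
  rintro ⟨Δ, Φ⟩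
  induction Φ with
  | nil => rintro ⟨Δ', _ | _⟩ h <;> simp_all [FOTransduction.code]
  | cons a Φ ih =>
    rintro ⟨Δ', _ | @⟨_, _, _, b, Ψ⟩⟩ h
    · simp [FOTransduction.code] at h
    · simp [FOTransduction.code] at h
      have := @FOOp.code_injective _ (Sigma.mk _ a) (Sigma.mk _ b) h.1
      cases this
      cases @ih (Sigma.mk _ Ψ) h.2
      rfl

/-! ### Graphs, orderings and widths -/

/-- The signature `{E}`, with `E` binary. -/
abbrev graphSignature : Signature := [2]

/-- The signature `{E, <}`, with `E` and `<` binary. -/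
abbrev orderedGraphSignature : Signature := graphSignature ++ [2]

/-- A directed graph (loops are allowed) as a structure over `{E}`. -/
def graphStructure {V : Type u} (G : Digraph V) : RelStructure.{u} graphSignature :=
  RelStructure.ofRel V fun {r} R x =>
    have hr : r = 2 := by
      have := List.mem_of_getElem? R.2
      simpa using this
    G.Adj (x ⟨0, by omega⟩) (x ⟨1, by omega⟩)

/-- The structure `(V, E, <)` over `{E, <}` given by a directed graph `(V, E)` and a binary
relation `<` on `V`. -/
def orderedGraphStructure {V : Type u} (G : Digraph V) (lt : V → V → Prop) :
    RelStructure.{u} orderedGraphSignature :=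
  RelStructure.ofRel V fun {r} R x =>
    have hr : r = 2 := by
      have := List.mem_of_getElem? R.2
      simpa using this
    match R.1 with
    | 0 => G.Adj (x ⟨0, by omega⟩) (x ⟨1, by omega⟩)
    | _ => lt (x ⟨0, by omega⟩) (x ⟨1, by omega⟩)

/-- A tournament: a loopless directed graph with exactly one of the two possible edges between any
two distinct vertices. -/
def IsTournament {V : Type u} (T : Digraph V) : Prop :=
  (∀ v, ¬ T.Adj v v) ∧ ∀ u v, u ≠ v → Xor (T.Adj u v) (T.Adj v u)

/-- Addition of a new vertex `none` to a labelled graph: there is the edge `u → none` when the label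
of `u` is in `X`, and the edge `none → u` otherwise. -/
def addVertex {V : Type u} {k : ℕ} (T : Digraph V) (lab : V → Fin k) (X : Set (Fin k)) :
    Digraph (Option V) where
  Adj
    | some u, some v => T.Adj u v
    | some u, none => lab u ∈ X
    | none, some u => lab u ∉ X
    | none, none => False

/-- The class of `k`-labelled tournaments that are obtained from the empty tournament by vertex
additions and relabellings (up to isomorphism). -/
inductive LinearNLC (k : ℕ) : {V : Type u} → Digraph V → (V → Fin k) → Prop
  | empty {V : Type u} [IsEmpty V] (T : Digraph V) (lab : V → Fin k) : LinearNLC k T lab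
  | vertexAddition {V : Type u} {T : Digraph V} {lab : V → Fin k} (X : Set (Fin k)) (c : Fin k) :
      LinearNLC k T lab → LinearNLC k (addVertex T lab X) (fun v => v.elim c lab)
  | relabelling {V : Type u} {T : Digraph V} {lab : V → Fin k} (ρ : Fin k → Fin k) :
      LinearNLC k T lab → LinearNLC k T (ρ ∘ lab)
  | iso {V W : Type u} {T : Digraph V} {lab : V → Fin k} (e : W ≃ V) (T' : Digraph W)
      (hT : ∀ u v, T'.Adj u v ↔ T.Adj (e u) (e v)) :
      LinearNLC k T lab → LinearNLC k T' (lab ∘ e)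

/-- The linear NLC-width of a tournament: the least `k` such that, with a suitable labelling, it
belongs to the class above (`⊤` if there is none). -/
noncomputable def linearNLCWidth {V : Type u} (T : Digraph V) : ℕ∞ :=
  ⨅ (k : ℕ) (_ : ∃ lab : V → Fin k, LinearNLC k T lab), (k : ℕ∞)

open Classical in
/-- The rank over the two-element field of the adjacency matrix of `G`, restricted to the rows in
`X` and the columns in `Y`. -/
noncomputable def rankBetween {V : Type u} [Fintype V] (G : Digraph V) (X Y : Set V) : ℕ :=
  (Matrix.of fun (x : X) (y : Y) => if G.Adj x y then (1 : ZMod 2) else 0).rank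

/-- The cut-rank of a linear ordering `<` of a finite graph: the maximal rank between
`{x | x ≤ v}` and `{y | v < y}`, for a vertex `v`. It is `0` for the empty graph. -/
noncomputable def cutRank {V : Type u} [Fintype V] (G : Digraph V) (lt : V → V → Prop) : ℕ :=
  Finset.univ.sup fun v => rankBetween G {x | lt x v ∨ x = v} {y | lt v y}

/-! A vertex sequence witnessing linear NLC-width at most `k` has at most `k` different rows at each
time. This order itself need not be definable; the proof builds another linear ordering, still with
boundedly many rows at every cut, that is first-order definable from `E` and boundedly many colours.

Suppose that some of the possible rows are known sets `S j` and that at most `m` further rows occur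
(`FewRows`). Cut the sequence into blocks, each ending as soon as every vertex before the block has
a known row from then on. The edge between a vertex and one at least two blocks away is then
determined by finitely many types (`FewRows.exists_blocks`). An edge that contradicts the prediction
for "u much later than v" is evidence (`Blocks.Ev`) that `u` is not much later. In a tournament,
vertices of the same type in different blocks always give such evidence, so with the block number
modulo 3 in the type and a parity colour their blocks can be compared definably. The transitive
closure of the evidence is definable because there are finitely many types (`UDef.reflTransGen`). It
respects the order of the blocks, and counting predecessors turns it into a definable linear
preorder (`Blocks.key`).

Vertices with equal keys lie in one block. If the block is longer than one time step, some vertex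
before it has an unknown row through all its proper cuts. Declaring that row known lowers `m` by one
(`FewRows.restrict`), so the classes are ordered recursively, and `UDef.glue` combines their
orderings without using new colours for each class. `Blocks.hasDefinableOrder` bounds the rows of
the combined ordering.

The transduction guesses the colours of one universal formula (`univRel`), keeps the linear
orderings, and keeps those with at most `N` rows at each cut, counted by first representatives.
These filters give soundness on every graph, as the number of rows bounds the rank. The bounds and
the codes are given by explicit recursions. -/

/-! ### A universal family of definable binary relations -/

/-- The number of nodes of the universal formula of depth `d`. -/
def nodeCount : ℕ → ℕ
  | 0 => 1
  | d + 1 => 1 + 2 * nodeCount d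

/-- The universal formula of depth `d`, evaluated in a coloured digraph. The node with number `o`
uses the colours `3 * o`, `3 * o + 1`, `3 * o + 2`; the nodes below it have the numbers that
follow `o`. -/
def univRel {V : Type*} (E : V → V → Prop) (col : ℕ → V → Prop) : ℕ → ℕ → V → V → Prop
  | 0, o, s, t => (col (3 * o) s ∧ E s t) ∨ (col (3 * o + 1) s ∧ s = t) ∨ col (3 * o + 2) s
  | d + 1, o, s, t =>
      (col (3 * o) s → univRel E col d (o + 1) s t → univRel E col d (o + 1 + nodeCount d) s t) ∧
      (col (3 * o + 1) s →
        ∀ z, univRel E col d (o + 1) s z → univRel E col d (o + 1 + nodeCount d) z t) ∧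
      (col (3 * o + 2) s → univRel E col d (o + 1) t s)

/-- The subformula at node `o` reads only the `3 * nodeCount d` colours from `3 * o` on. Colourings
of two subformulas can therefore be laid side by side, as in `UDef.node`. -/
theorem univRel_congr {V : Type*} {E : V → V → Prop} {col col' : ℕ → V → Prop} (d : ℕ) :
    ∀ o o' : ℕ, (∀ j < 3 * nodeCount d, ∀ v, col (3 * o + j) v ↔ col' (3 * o' + j) v) →
      ∀ s t, univRel E col d o s t ↔ univRel E col' d o' s t := by
  induction d with
  | zero =>
    intro o o' h s t
    simp only [nodeCount] at h
    have h0 := h 0 (by norm_num) s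
    have h1 := h 1 (by norm_num) s
    have h2 := h 2 (by norm_num) s
    simp only [Nat.add_zero] at h0
    simp only [univRel, h0, h1, h2]
  | succ d ih =>
    intro o o' h s t
    simp only [nodeCount] at h
    have h0 := h 0 (by omega) s
    have h1 := h 1 (by omega) s
    have h2 := h 2 (by omega) s
    simp only [Nat.add_zero] at h0
    have hl := ih (o + 1) (o' + 1) fun j hj v => by
      have := h (3 + j) (by omega) v
      convert this using 2 <;> ring
    have hr := ih (o + 1 + nodeCount d) (o' + 1 + nodeCount d) fun j hj v => by
      have := h (3 + 3 * nodeCount d + j) (by omega) v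
      convert this using 2 <;> ring
    simp only [univRel, h0, h1, h2, hl, hr]

/-- The binary relation `R` is definable by the universal formula of depth `d`, for a suitable
colouring. -/
def UDef {V : Type*} (E : V → V → Prop) (d : ℕ) (R : V → V → Prop) : Prop :=
  ∃ col : ℕ → V → Prop, ∀ s t, R s t ↔ univRel E col d 0 s t

namespace UDef

variable {V : Type*} {E : V → V → Prop} {d d' : ℕ} {A B R : V → V → Prop}

theorem congr (h : UDef E d A) (hAB : ∀ s t, B s t ↔ A s t) : UDef E d B := by
  obtain ⟨col, hc⟩ := h
  exact ⟨col, fun s t => (hAB s t).trans (hc s t)⟩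

theorem leaf (P Q R : V → Prop) :
    UDef E 0 fun s t => (P s ∧ E s t) ∨ (Q s ∧ s = t) ∨ R s := by
  refine ⟨fun j => if j = 0 then P else if j = 1 then Q else R, fun s t => ?_⟩
  simp [univRel]

/-- Constant `P`, `Q`, `R` select implication, universal composition or converse, from which all
other connectives are built. In `glue` they vary with the vertex, so that different classes can use
different operations. -/
theorem node (hA : UDef E d A) (hB : UDef E d B) (P Q R : V → Prop) :
    UDef E (d + 1) fun s t =>
      (P s → A s t → B s t) ∧ (Q s → ∀ z, A s z → B z t) ∧ (R s → A t s) := by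
  obtain ⟨a, ha⟩ := hA
  obtain ⟨b, hb⟩ := hB
  let col : ℕ → V → Prop := fun j =>
    if j = 0 then P else if j = 1 then Q else if j = 2 then R else
      if j < 3 + 3 * nodeCount d then a (j - 3) else b (j - (3 + 3 * nodeCount d))
  have hl : ∀ s t, univRel E col d 1 s t ↔ A s t := fun s t => by
    rw [ha]
    refine univRel_congr d _ _ (fun j hj v => ?_) s t
    simp only [col]
    rw [if_neg (by omega), if_neg (by omega), if_neg (by omega), if_pos (by omega)]
    simp
  have hr : ∀ s t, univRel E col d (1 + nodeCount d) s t ↔ B s t := fun s t => by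
    rw [hb]
    refine univRel_congr d _ _ (fun j hj v => ?_) s t
    simp only [col]
    rw [if_neg (by omega), if_neg (by omega), if_neg (by omega), if_neg (by omega)]
    rw [show 3 * (1 + nodeCount d) + j - (3 + 3 * nodeCount d) = 3 * 0 + j by omega]
  refine ⟨col, fun s t => ?_⟩
  simp only [univRel, Nat.zero_add, hl, hr]
  simp [col]

theorem true' : ∀ d, UDef E d fun _ _ => True
  | 0 => (leaf (fun _ => False) (fun _ => False) fun _ => True).congr (by simp)
  | d + 1 => (node (true' d) (true' d) (fun _ => False) (fun _ => False) fun _ => False).congr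
      (by simp)

theorem succ (hA : UDef E d A) : UDef E (d + 1) A :=
  (node (true' d) hA (fun _ => True) (fun _ => False) fun _ => False).congr (by simp)

theorem mono (hA : UDef E d A) (h : d ≤ d') : UDef E d' A := by
  induction h with
  | refl => exact hA
  | step _ ih => exact ih.succ

theorem false' (d : ℕ) : UDef E d fun _ _ => False :=
  mono ((leaf (fun _ => False) (fun _ => False) fun _ => False).congr (by simp)) d.zero_le

theorem edge (d : ℕ) : UDef E d E :=
  mono ((leaf (fun _ => True) (fun _ => False) fun _ => False).congr (by simp)) d.zero_le

theorem eq (d : ℕ) : UDef E d fun s t => s = t :=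
  mono ((leaf (fun _ => False) (fun _ => True) fun _ => False).congr (by simp)) d.zero_le

theorem left (P : V → Prop) (d : ℕ) : UDef E d fun s _ => P s :=
  mono ((leaf (fun _ => False) (fun _ => False) P).congr (by simp)) d.zero_le

theorem imp (hA : UDef E d A) (hB : UDef E d B) : UDef E (d + 1) fun s t => A s t → B s t :=
  (node hA hB (fun _ => True) (fun _ => False) fun _ => False).congr (by simp)

theorem allComp (hA : UDef E d A) (hB : UDef E d B) :
    UDef E (d + 1) fun s t => ∀ z, A s z → B z t :=
  (node hA hB (fun _ => False) (fun _ => True) fun _ => False).congr (by simp)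

theorem swap (hA : UDef E d A) : UDef E (d + 1) fun s t => A t s :=
  (node hA hA (fun _ => False) (fun _ => False) fun _ => True).congr (by simp)

theorem not (hA : UDef E d A) : UDef E (d + 1) fun s t => ¬ A s t :=
  (imp hA (false' d)).congr fun _ _ => Iff.rfl

theorem and (hA : UDef E d A) (hB : UDef E d B) : UDef E (d + 3) fun s t => A s t ∧ B s t :=
  (imp hA.succ hB.not).not.congr fun _ _ => by tauto

theorem or (hA : UDef E d A) (hB : UDef E d B) : UDef E (d + 2) fun s t => A s t ∨ B s t :=
  (imp hA.not hB.succ).congr fun _ _ => by tauto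

theorem iff (hA : UDef E d A) (hB : UDef E d B) : UDef E (d + 4) fun s t => A s t ↔ B s t :=
  (and (imp hA hB) (imp hB hA)).congr fun _ _ => by tauto

theorem comp (hA : UDef E d A) (hB : UDef E d B) :
    UDef E (d + 3) fun s t => ∃ z, A s z ∧ B z t :=
  (allComp hA.succ hB.not).not.congr fun _ _ => by push Not; rfl

theorem right (P : V → Prop) (d : ℕ) : UDef E (d + 1) fun _ t => P t :=
  (left P d).swap

theorem exists_fin {M : ℕ} {R : Fin M → V → V → Prop} (h : ∀ i, UDef E d (R i)) :
    UDef E (d + 2 * M) fun s t => ∃ i, R i s t := by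
  induction M with
  | zero => exact (false' _).congr (by simp)
  | succ M ih =>
    have := (mono (h 0) (Nat.le_add_right d (2 * M))).or (ih fun i => h i.succ)
    exact this.congr fun s t => Fin.exists_fin_succ

theorem forall_fin {M : ℕ} {R : Fin M → V → V → Prop} (h : ∀ i, UDef E d (R i)) :
    UDef E (d + 2 * M + 2) fun s t => ∀ i, R i s t :=
  ((exists_fin fun i => (h i).not).not.mono (by omega)).congr fun s t => by simp

/-- A relation between the values of a function to a finite type is definable. -/
theorem fiberRel {M : ℕ} (f : V → Fin M) (r : Fin M → Fin M → Prop) :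
    UDef E (4 + 2 * M) fun s t => r (f s) (f t) :=
  (exists_fin fun i => (left (fun s => f s = i) 1).and (right (fun t => r i (f t)) 0)).congr
    fun s t => by simp

/-- Relations that are definable within the classes of a definable partition can be glued. -/
theorem glue {ι : Type*} (κ : V → ι) {c : ℕ} (hκ : UDef E c fun u v => κ u = κ v)
    {R : ∀ i, {v // κ v = i} → {v // κ v = i} → Prop}
    (hR : ∀ i, UDef (fun a b : {v // κ v = i} => E a b) d (R i)) :
    UDef E (c + 4 * d + 3) fun u v => ∃ h : κ v = κ u, R (κ u) ⟨u, rfl⟩ ⟨v, h⟩ := by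
  choose col hcol using hR
  -- Colours are tested at single vertices, so each vertex can carry the colours of its own class.
  let C : ℕ → V → Prop := fun j v => col (κ v) j ⟨v, rfl⟩
  have hC : ∀ (i : ι) (v : {v // κ v = i}) (j : ℕ), C j v ↔ col i j v := by
    rintro _ ⟨v, rfl⟩ j; rfl
  have key : ∀ d o, ∃ A : V → V → Prop, UDef E (c + 4 * d) A ∧
      ∀ (i : ι) (u v : {v // κ v = i}),
        A u v ↔ univRel (fun a b : {v // κ v = i} => E a b) (col i) d o u v := by
    intro d
    induction d with
    | zero =>
      intro o
      refine ⟨_, (leaf (C (3 * o)) (C (3 * o + 1)) (C (3 * o + 2))).mono (Nat.zero_le _),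
        fun i u v => ?_⟩
      simp only [univRel, hC, Subtype.ext_iff]
    | succ d ih =>
      intro o
      obtain ⟨A, hA, hA'⟩ := ih (o + 1)
      obtain ⟨B, hB, hB'⟩ := ih (o + 1 + nodeCount d)
      -- A guard on the left subrelation suffices: it confines `z` to the class and is void for
      -- arguments that already lie in it. It costs 3 and the node 1, hence the factor 4.
      refine ⟨_, node ((hκ.mono (Nat.le_add_right c (4 * d))).and hA) (hB.mono (by omega))
        (C (3 * o)) (C (3 * o + 1)) (C (3 * o + 2)), fun i u v => ?_⟩
      have hu := u.2
      have hv := v.2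
      simp only [univRel, hC, ← hA', ← hB', Subtype.forall, hu, hv, true_and, and_imp]
      refine and_congr Iff.rfl (and_congr (imp_congr Iff.rfl ?_) Iff.rfl)
      exact ⟨fun h z hz => h z hz.symm, fun h z hz => h z hz.symm⟩
  obtain ⟨A, hA, hA'⟩ := key d 0
  refine ((hκ.mono (Nat.le_add_right c (4 * d))).and hA).congr fun u v => ?_
  constructor
  · rintro ⟨h, hr⟩
    exact ⟨h.symm, (hA' _ ⟨u, rfl⟩ ⟨v, h⟩).2 ((hcol _ _ _).1 hr)⟩
  · rintro ⟨h, hr⟩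
    exact ⟨h.symm, (hcol _ _ _).2 ((hA' _ ⟨u, rfl⟩ ⟨v, h.symm⟩).1 hr)⟩

end UDef

/-! ### Definable linear orderings from block structures -/

/-- Reachability is definable when it is definable between vertices of the same type, for finitely
many types. -/
theorem UDef.reflTransGen {V : Type*} {E link S : V → V → Prop} {d M : ℕ} (ty : V → Fin M)
    (hl : UDef E d link) (hS : UDef E d S)
    (hSl : ∀ u v, S u v ↔ ty u = ty v ∧ Relation.ReflTransGen link u v) :
    UDef E (d + 3 + 8 * M) (Relation.ReflTransGen link) := by
  -- A Floyd–Warshall recursion over types: stage `j + 1` also allows one jump along `S` between two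
  -- vertices of type `j`, replacing all passages through that type.
  let R : ℕ → V → V → Prop := fun j => Nat.rec (fun u v => u = v ∨ link u v)
    (fun j R u v => R u v ∨ ∃ z, R u z ∧ ∃ w, (S z w ∧ (ty z).1 = j) ∧ R w v) j
  have hR0 : ∀ u v, R 0 u v ↔ u = v ∨ link u v := fun _ _ => Iff.rfl
  have hRs : ∀ j u v, R (j + 1) u v ↔
      R j u v ∨ ∃ z, R j u z ∧ ∃ w, (S z w ∧ (ty z).1 = j) ∧ R j w v :=
    fun _ _ _ => Iff.rfl
  have hdef : ∀ j, UDef E (d + 3 + 8 * j) (R j) := by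
    intro j
    induction j with
    | zero => exact ((UDef.eq d).or hl).mono (by omega)
    | succ j ih =>
      exact (ih.mono (Nat.le_add_right _ 6)).or
        ((ih.mono (Nat.le_add_right _ 3)).comp
          (((hS.and (UDef.left (fun z => (ty z).1 = j) d)).mono (by omega)).comp ih))
  have hsub : ∀ j u v, R j u v → Relation.ReflTransGen link u v := by
    intro j
    induction j with
    | zero =>
      rintro u v (rfl | h)
      exacts [.refl, .single h]
    | succ j ih =>
      rintro u v (h | ⟨z, hz, w, hw, h⟩)
      exacts [ih _ _ h, ((ih _ _ hz).trans ((hSl _ _).1 hw.1).2).trans (ih _ _ h)]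
  have hbase : ∀ j u v, (u = v ∨ link u v) → R j u v := by
    intro j
    induction j with
    | zero => exact fun u v h => h
    | succ j ih => exact fun u v h => Or.inl (ih u v h)
  have hstep : ∀ j u w v, R j u w → (ty w).1 < j → link w v → R j u v := by
    intro j
    induction j with
    | zero => intro _ _ _ _ h; omega
    | succ j ih =>
      rintro u w v h hw hwv
      have hS' : ∀ a b, ty a = ty b → R j a b → S a b := fun a b hab h =>
        (hSl a b).2 ⟨hab, hsub j a b h⟩
      rcases Nat.lt_succ_iff_lt_or_eq.1 hw with hw | hw
      · rcases h with h | ⟨z, hz, x, hx, h⟩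
        · exact Or.inl (ih _ _ _ h hw hwv)
        · exact Or.inr ⟨z, hz, x, hx, ih _ _ _ h hw hwv⟩
      · rcases h with h | ⟨z, hz, x, hx, h⟩
        · exact Or.inr ⟨w, h, w, ⟨hS' _ _ rfl (hbase j _ _ (Or.inl rfl)), hw⟩,
            hbase j _ _ (Or.inr hwv)⟩
        -- The path returns to type `j` at `w`, so the earlier jump and the stretch after it merge
        -- into a single jump from `z` to `w`.
        · obtain ⟨hx, hzj⟩ := hx
          have hzw : ty z = ty w := Fin.ext (hzj.trans hw.symm)
          exact Or.inr ⟨z, hz, w, ⟨(hSl _ _).2 ⟨hzw,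
            ((hSl _ _).1 hx).2.trans (hsub j _ _ h)⟩, hzj⟩, hbase j _ _ (Or.inr hwv)⟩
  refine (hdef M).congr fun u v => ⟨fun h => ?_, hsub M u v⟩
  induction h with
  | refl => exact hbase M _ _ (Or.inl rfl)
  | tail _ h ih => exact hstep M _ _ _ ih (ty _).2 h

/-- Every cut of the ordering `L` has at most `N` different rows. -/
def CutClasses {V : Type*} (E L : V → V → Prop) (N : ℕ) : Prop :=
  ∀ v, ∃ g : V → Fin N, ∀ x x', (L x v ∨ x = v) → (L x' v ∨ x' = v) → g x = g x' →
    ∀ y, L v y → (E x y ↔ E x' y)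

/-- There is a definable linear ordering whose cuts have few different rows. -/
def HasDefinableOrder {V : Type*} (E : V → V → Prop) (d N : ℕ) : Prop :=
  ∃ L : V → V → Prop, UDef E d L ∧ IsStrictTotalOrder V L ∧ CutClasses E L N

/-- A partition of the vertices of a digraph into a sequence of blocks, with finitely many types of
vertices that determine the edges from a vertex to vertices of earlier, non-adjacent blocks. -/
structure Blocks {V : Type*} (E : V → V → Prop) (M K : ℕ) where
  blk : V → ℕ
  ty : V → Fin M
  back : Fin M → Fin M → Prop
  near : V → Fin K
  far : ∀ u v, blk v + 2 ≤ blk u → (E u v ↔ back (ty u) (ty v))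
  residue : ∀ u v, ty u = ty v → blk u % 3 = blk v % 3
  adjacent : ∀ x x', blk x = blk x' → near x = near x' →
    ∀ y, (blk y = blk x + 1 ∨ blk y + 1 = blk x) → (E x y ↔ E x' y)

namespace Blocks

variable {V : Type*} {E : V → V → Prop} {M K : ℕ} (b : Blocks E M K)

/-! ### Comparing the blocks of vertices of the same type -/

/-- The edge between `u` and `v` shows that `u` is not in a much later block than `v`. -/
def Ev (u v : V) : Prop := ¬ (E u v ↔ b.back (b.ty u) (b.ty v))

theorem Ev.le {u v : V} (h : b.Ev u v) : b.blk u ≤ b.blk v + 1 := by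
  by_contra hc
  exact h (b.far u v (by omega))

/-- Equal types have equal residues, so the blocks are at least three apart and `far` predicts the
edge from `v` to `u`. The prediction for the pair `u`, `v` is the same because the types agree, but
the edge is the opposite one. -/
theorem ev_of_lt (hE : ∀ u v, u ≠ v → (E u v ↔ ¬ E v u)) {u v : V} (ht : b.ty u = b.ty v)
    (h : b.blk u < b.blk v) : b.Ev u v := by
  have hr := b.residue u v ht
  have hf := b.far v u (by omega)
  have hne : u ≠ v := by rintro rfl; omega
  intro hc
  rw [hE u v hne, hf, ht] at hc
  tauto

theorem Ev.le_of_mod {u v : V} (h : b.Ev u v) (hr : b.blk u % 3 = b.blk v % 3) :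
    b.blk u ≤ b.blk v := by
  have := Ev.le b h
  omega

open Classical in
/-- The number of earlier blocks that contain a vertex of the same type. -/
noncomputable def idx [Fintype V] (v : V) : ℕ :=
  ((Finset.univ.filter fun w => b.ty w = b.ty v ∧ b.blk w < b.blk v).image b.blk).card

/-- Take `w` in the next block that contains the type: its index is one larger, so the parity
changes, and equal parities put `v` later still. -/
theorem exists_between [Fintype V] {u v : V} (ht : b.ty u = b.ty v) (h : b.blk u < b.blk v)
    (hi : b.idx u % 2 = b.idx v % 2) :
    ∃ w, b.ty w = b.ty u ∧ b.blk u < b.blk w ∧ b.blk w < b.blk v ∧ b.idx w % 2 ≠ b.idx u % 2 := by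
  classical
  obtain ⟨w, hw, hmin⟩ := Finset.exists_min_image
    (Finset.univ.filter fun w => b.ty w = b.ty u ∧ b.blk u < b.blk w) b.blk ⟨v, by simp [ht, h]⟩
  simp only [Finset.mem_filter, Finset.mem_univ, true_and] at hw hmin
  have hidx : b.idx w = b.idx u + 1 := by
    unfold idx
    rw [← Finset.card_insert_of_notMem (a := b.blk u) (by simp +contextual [ne_of_lt])]
    congr 1
    ext n
    simp only [Finset.mem_image, Finset.mem_filter, Finset.mem_univ, true_and, Finset.mem_insert]
    constructor
    · rintro ⟨x, ⟨hx, hxw⟩, rfl⟩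
      rcases lt_trichotomy (b.blk x) (b.blk u) with h1 | h1 | h1
      · exact Or.inr ⟨x, ⟨hx.trans hw.1, h1⟩, rfl⟩
      · exact Or.inl h1
      · have := hmin x ⟨hx.trans hw.1, h1⟩
        omega
    · rintro (rfl | ⟨x, ⟨hx, hxu⟩, rfl⟩)
      · exact ⟨u, ⟨hw.1.symm, hw.2⟩, rfl⟩
      · exact ⟨x, ⟨hx.trans hw.1.symm, hxu.trans hw.2⟩, rfl⟩
  refine ⟨w, hw.1, hw.2, lt_of_le_of_ne (hmin v ⟨ht.symm, h⟩) fun he => ?_, by omega⟩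
  have : b.idx w = b.idx v := by
    unfold idx
    rw [hw.1, ht, he]
  omega

/-- `u` and `v` have the same type, and the block of `u` is the earlier one. -/
def SLt (u v : V) : Prop := b.ty u = b.ty v ∧ b.blk u < b.blk v

/-- `u` and `v` have the same type, and the block of `u` is not the later one. -/
def SLe (u v : V) : Prop := b.ty u = b.ty v ∧ b.blk u ≤ b.blk v

theorem udef_ev : UDef E (2 * M + 9) b.Ev :=
  ((UDef.edge _).iff (UDef.fiberRel b.ty b.back)).not.mono (by omega)

/-- Within a block `Ev` may also hold between vertices of the same type. Different parities of `idx`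
exclude this, and two steps with a parity change reach the later blocks of equal parity. -/
theorem udef_sLt [Fintype V] (hE : ∀ u v, u ≠ v → (E u v ↔ ¬ E v u)) :
    UDef E (2 * M + 20) b.SLt := by
  have hA : UDef E (2 * M + 15) fun u v =>
      b.ty u = b.ty v ∧ (Fin.ofNat 2 (b.idx u) ≠ Fin.ofNat 2 (b.idx v) ∧ b.Ev u v) :=
    ((UDef.fiberRel b.ty (· = ·)).mono (by omega)).and
      (((UDef.fiberRel (fun u => Fin.ofNat 2 (b.idx u)) (· ≠ ·)).mono (by omega)).and b.udef_ev)
  have hne : ∀ u v, Fin.ofNat 2 (b.idx u) ≠ Fin.ofNat 2 (b.idx v) ↔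
      b.idx u % 2 ≠ b.idx v % 2 := fun u v => by simp [Fin.ext_iff]
  have hlt : ∀ u v, b.ty u = b.ty v → b.idx u % 2 ≠ b.idx v % 2 → b.Ev u v →
      b.blk u < b.blk v := by
    intro u v ht hi he
    refine lt_of_le_of_ne (Ev.le_of_mod b he (b.residue u v ht)) fun hb => hi ?_
    unfold idx
    rw [ht, hb]
  refine ((hA.mono (by omega)).or (hA.comp hA)).congr fun u v => ?_
  simp only [hne]
  constructor
  · rintro ⟨ht, h⟩
    by_cases hi : b.idx u % 2 = b.idx v % 2
    · obtain ⟨w, hw, h1, h2, h3⟩ := b.exists_between ht h hi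
      exact Or.inr ⟨w, ⟨hw.symm, h3.symm, b.ev_of_lt hE hw.symm h1⟩,
        hw.trans ht, by omega, b.ev_of_lt hE (hw.trans ht) h2⟩
    · exact Or.inl ⟨ht, hi, b.ev_of_lt hE ht h⟩
  · rintro (⟨ht, hi, he⟩ | ⟨w, ⟨ht, hi, he⟩, ht', hi', he'⟩)
    · exact ⟨ht, hlt _ _ ht hi he⟩
    · exact ⟨ht.trans ht', (hlt _ _ ht hi he).trans (hlt _ _ ht' hi' he')⟩

theorem udef_sLe [Fintype V] (hE : ∀ u v, u ≠ v → (E u v ↔ ¬ E v u)) :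
    UDef E (2 * M + 25) b.SLe :=
  (((UDef.fiberRel b.ty (· = ·)).mono (by omega)).and (b.udef_sLt hE).swap.not).congr
    fun u v => by
      simp only [SLe, SLt]
      constructor
      · rintro ⟨h, h'⟩
        exact ⟨h, fun h'' => by omega⟩
      · rintro ⟨h, h'⟩
        exact ⟨h, not_lt.1 fun h'' => h' ⟨h.symm, h''⟩⟩

/-! ### The definable preorder and its linearisation -/

/-- The evident reasons for `u` not to be in a later block than `v`. -/
def Link (u v : V) : Prop :=
  b.SLe u v ∨ (b.blk u % 3 = b.blk v % 3 ∧ b.Ev u v) ∨ ∃ w, b.Ev u w ∧ b.SLt w v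

/-- The preorder generated by `Link`. -/
def Le : V → V → Prop := Relation.ReflTransGen b.Link

/-- Every link respects the order of the blocks. In the third kind, `Ev` goes back by at most one
block while `SLt` advances by at least three. -/
theorem Le.blk_le {u v : V} (h : b.Le u v) : b.blk u ≤ b.blk v := by
  induction h with
  | refl => rfl
  | tail _ h ih =>
    refine ih.trans ?_
    rcases h with h | h | ⟨w, h, h'⟩
    · exact h.2
    · exact Ev.le_of_mod b h.2 h.1
    · have h1 := Ev.le b h
      have h2 := b.residue _ _ h'.1
      have h3 := h'.2
      omega

/-- Between vertices of one type, reachability is no more than the relation `SLe`, already shown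
definable. This is the hypothesis of `UDef.reflTransGen`. -/
theorem sLe_iff {u v : V} : b.SLe u v ↔ b.ty u = b.ty v ∧ b.Le u v :=
  ⟨fun h => ⟨h.1, .single (Or.inl h)⟩, fun h => ⟨h.1, Le.blk_le b h.2⟩⟩

theorem udef_le [Fintype V] (hE : ∀ u v, u ≠ v → (E u v ↔ ¬ E v u)) :
    UDef E (10 * M + 40) b.Le := by
  have h3 : UDef E (2 * M + 13) fun u v =>
      Fin.ofNat 3 (b.blk u) = Fin.ofNat 3 (b.blk v) ∧ b.Ev u v :=
    ((UDef.fiberRel (fun u => Fin.ofNat 3 (b.blk u)) (· = ·)).mono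
      (d' := 2 * M + 10) (by omega)).and (b.udef_ev.mono (by omega))
  have hl : UDef E (2 * M + 37) b.Link := by
    refine UDef.congr (((b.udef_sLe hE).or ((h3.mono (d' := 2 * M + 23) (by omega)).or
      ((b.udef_ev.mono (d' := 2 * M + 20) (by omega)).comp (b.udef_sLt hE)))).mono (by omega))
      fun u v => ?_
    simp [Link, Fin.ext_iff]
  exact (UDef.reflTransGen b.ty hl ((b.udef_sLe hE).mono (by omega))
    fun u v => b.sLe_iff).mono (by omega)

open Classical in
/-- The number of vertices of type `i` that precede `x` in the preorder. -/
noncomputable def count [Fintype V] (i : Fin M) (x : V) : ℕ :=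
  (Finset.univ.filter fun p => b.ty p = i ∧ b.Le p x).card

/-- The vertices of type `i` form a chain for `Le`, so the counted sets are nested, and comparing
cardinalities amounts to a first-order inclusion. -/
theorem count_lt_iff [Fintype V] (i : Fin M) (x y : V) :
    b.count i x < b.count i y ↔ ¬ ∀ p, (b.ty p = i ∧ b.Le p y) → b.Le p x := by
  classical
  constructor
  · intro h hc
    refine absurd (Finset.card_le_card fun p hp => ?_) (not_le.2 h)
    simp only [Finset.mem_filter, Finset.mem_univ, true_and] at hp ⊢
    exact ⟨hp.1, hc p hp⟩
  · intro h
    push Not at h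
    obtain ⟨p, ⟨hp, hpy⟩, hpx⟩ := h
    refine Finset.card_lt_card (Finset.ssubset_iff_of_subset (fun q hq => ?_) |>.2
      ⟨p, by simp [hp, hpy], by simp [hpx]⟩)
    simp only [Finset.mem_filter, Finset.mem_univ, true_and] at hq ⊢
    refine ⟨hq.1, ?_⟩
    have hqp : b.ty q = b.ty p := hq.1.trans hp.symm
    rcases le_total (b.blk q) (b.blk p) with h | h
    · exact (b.sLe_iff.1 ⟨hqp, h⟩).2.trans hpy
    · exact absurd ((b.sLe_iff.1 ⟨hqp.symm, h⟩).2.trans hq.2) hpx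

/-- A linear preordering that extends the preorder. -/
noncomputable def key [Fintype V] (x : V) : Lex (Fin M → ℕ) := toLex fun i => b.count i x

theorem key_lt_iff [Fintype V] (x y : V) : b.key x < b.key y ↔
    ∃ i, (∀ j, j < i → ¬ b.count j x < b.count j y ∧ ¬ b.count j y < b.count j x) ∧
      b.count i x < b.count i y := by
  refine (Iff.rfl : _ ↔ Pi.Lex (· < ·) (· < ·) _ _).trans (exists_congr fun i =>
    and_congr (forall₂_congr fun j _ => ?_) Iff.rfl)
  change b.count j x = b.count j y ↔ _
  omega

/-- Since `x` is among the vertices of its own type below `x`, equality of the counts for `ty x`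
already forces `Le x y`. -/
theorem key_eq_iff [Fintype V] (x y : V) : b.key x = b.key y ↔ b.Le x y ∧ b.Le y x := by
  constructor
  · intro h
    have h' : ∀ i, b.count i x = b.count i y := fun i => congrFun h i
    constructor
    · by_contra hc
      exact absurd ((b.count_lt_iff (b.ty x) y x).2 fun hh => hc (hh x ⟨rfl, .refl⟩))
        (by rw [h']; exact lt_irrefl _)
    · by_contra hc
      exact absurd ((b.count_lt_iff (b.ty y) x y).2 fun hh => hc (hh y ⟨rfl, .refl⟩))
        (by rw [h']; exact lt_irrefl _)
  · rintro ⟨h1, h2⟩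
    refine congrArg toLex (funext fun i => le_antisymm ?_ ?_)
    · exact not_lt.1 fun h => (b.count_lt_iff i y x).1 h fun p hp => hp.2.trans h1
    · exact not_lt.1 fun h => (b.count_lt_iff i x y).1 h fun p hp => hp.2.trans h2

theorem key_lt [Fintype V] {x y : V} (h : b.Le x y) (h' : ¬ b.Le y x) : b.key x < b.key y := by
  refine lt_of_le_of_ne ?_ fun he => h' ((b.key_eq_iff x y).1 he).2
  exact Pi.toLex_monotone fun i =>
    not_lt.1 fun hlt => (b.count_lt_iff i y x).1 hlt fun p hp => hp.2.trans h

theorem udef_count_lt [Fintype V] (hE : ∀ u v, u ≠ v → (E u v ↔ ¬ E v u)) (i : Fin M) :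
    UDef E (10 * M + 47) fun x y => b.count i x < b.count i y := by
  have h : UDef E (10 * M + 43) fun p y => b.ty p = i ∧ b.Le p y :=
    (UDef.left (fun p => b.ty p = i) _).and (b.udef_le hE)
  exact (h.swap.allComp ((b.udef_le hE).mono (by omega))).not.swap.congr
    fun x y => b.count_lt_iff i x y

theorem udef_key_lt [Fintype V] (hE : ∀ u v, u ≠ v → (E u v ↔ ¬ E v u)) :
    UDef E (14 * M + 58) fun x y => b.key x < b.key y := by
  have hc := b.udef_count_lt hE
  have h (i : Fin M) : UDef E (12 * M + 55) fun x y =>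
      ∀ j, j < i → ¬ b.count j x < b.count j y ∧ ¬ b.count j y < b.count j x :=
    (UDef.forall_fin fun j => (UDef.left (fun _ => j < i) _).imp
      (((hc j).not.mono (Nat.le_succ _)).and (hc j).not.swap)).mono (by omega)
  exact ((UDef.exists_fin fun i => (h i).and ((hc i).mono (by omega))).mono (by omega)).congr
    fun x y => b.key_lt_iff x y

theorem udef_key_eq [Fintype V] (hE : ∀ u v, u ≠ v → (E u v ↔ ¬ E v u)) :
    UDef E (10 * M + 44) fun x y => b.key x = b.key y :=
  (((b.udef_le hE).succ).and (b.udef_le hE).swap).congr fun x y => b.key_eq_iff x y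

/-! ### Rows at a cut of the combined ordering -/

/-- If `x` precedes a cut and `y` does not, and their edge shows that `y` is not in a much later
block than `x`, then `x` is in the last block before the cut that meets the type of `x`. -/
theorem blk_le_of_ev [Fintype V] {x y z : V} (h : b.Ev y x) (ht : b.ty z = b.ty x)
    (hk : b.key z ≤ b.key y) : b.blk z ≤ b.blk x := by
  by_contra hc
  have hs : b.SLt x z := ⟨ht.symm, by omega⟩
  -- The third kind of link exists for this step: evidence against `x` places `y` below every later
  -- vertex of the type of `x`.
  have hl : b.Le y z := .single (Or.inr (Or.inr ⟨x, h, hs⟩))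
  refine absurd (b.key_lt hl fun hzy => ?_) (not_lt.2 hk)
  have h1 := Le.blk_le b hzy
  have h2 := Ev.le b h
  have h3 := b.residue _ _ ht
  omega

/-- The edges between two vertices of the same block with different keys depend only on the type of
one of them. -/
theorem edge_iff_of_key_ne [Fintype V] (hE : ∀ u v, u ≠ v → (E u v ↔ ¬ E v u)) {x x' y : V}
    (ht : b.ty x = b.ty x') (hb : b.blk x = b.blk x') (hy : b.blk y = b.blk x)
    (hk : b.key y ≠ b.key x) : E x y ↔ E x' y := by
  have h1 : b.Le x x' := (b.sLe_iff.1 ⟨ht, hb.le⟩).2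
  have h2 : b.Le x' x := (b.sLe_iff.1 ⟨ht.symm, hb.ge⟩).2
  have hkx := (b.key_eq_iff x x').2 ⟨h1, h2⟩
  have hnle : ¬ (b.Le x y ∧ b.Le y x) := fun h => hk ((b.key_eq_iff _ _).2 h.symm)
  have hyx : y ≠ x := fun h => hk (by rw [h])
  have hyx' : y ≠ x' := fun h => hk (by rw [h, hkx])
  have l1 : b.Ev x y → b.Le x y := fun h => .single (Or.inr (Or.inl ⟨by omega, h⟩))
  have l2 : b.Ev y x → b.Le y x := fun h => .single (Or.inr (Or.inl ⟨by omega, h⟩))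
  have l3 : b.Ev x' y → b.Le x y := fun h =>
    h1.trans (.single (Or.inr (Or.inl ⟨by omega, h⟩)))
  have l4 : b.Ev y x' → b.Le y x := fun h =>
    Relation.ReflTransGen.trans (.single (Or.inr (Or.inl ⟨by omega, h⟩))) h2
  have e1 := hE y x hyx
  have e2 := hE y x' hyx'
  unfold Ev at l1 l2 l3 l4
  rw [← ht] at l3 l4
  -- If `a` and `a'` differed, one of them would contradict `p` and one of `c`, `c'` would
  -- contradict `q`. This gives `Le` in both directions, so the keys would be equal.
  generalize E x y = a, E y x = c, E x' y = a', E y x' = c', b.back (b.ty x) (b.ty y) = p,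
    b.back (b.ty y) (b.ty x) = q, b.Le x y = r, b.Le y x = s at *
  clear h1 h2 hkx hk
  grind

/-- The step from orderings of the blocks to an ordering of the whole vertex set. -/
theorem hasDefinableOrder [Fintype V] (hE : ∀ u v, u ≠ v → (E u v ↔ ¬ E v u)) {d N : ℕ}
    (hrec : ∀ s : Set V, (∀ x ∈ s, ∀ y ∈ s, b.blk x = b.blk y) →
      HasDefinableOrder (fun x y : s => E x y) d N) :
    HasDefinableOrder E (14 * M + 4 * d + 60) (M * (1 + K * (1 + N))) := by
  have hrec' : ∀ i, HasDefinableOrder (fun x y : {v // b.key v = i} => E x y) d N := fun i =>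
    hrec {v | b.key v = i} fun x hx y hy => by
      obtain ⟨h1, h2⟩ := (b.key_eq_iff x y).1 (hx.trans hy.symm)
      exact le_antisymm (Le.blk_le b h1) (Le.blk_le b h2)
  choose R hR hto hcut using hrec'
  have hG := UDef.glue b.key (b.udef_key_eq hE) hR
  set G : V → V → Prop := fun u v => ∃ h : b.key v = b.key u, R (b.key u) ⟨u, rfl⟩ ⟨v, h⟩
    with hGdef
  have hGiff : ∀ i (u v : {v // b.key v = i}), G u v ↔ R i u v := by
    rintro _ ⟨u, rfl⟩ ⟨v, hv⟩
    exact ⟨fun ⟨_, h⟩ => h, fun h => ⟨hv, h⟩⟩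
  have hG' : ∀ u v, G u v → b.key v = b.key u := fun u v ⟨h, _⟩ => h
  have hsto : IsStrictTotalOrder V fun u v => b.key u < b.key v ∨ G u v := by
    refine { trichotomous := fun u v h1 h2 => ?_, irrefl := fun u h => ?_,
             trans := fun u v w h1 h2 => ?_ }
    · rw [not_or] at h1 h2
      have hk : b.key v = b.key u := le_antisymm (not_lt.1 h1.1) (not_lt.1 h2.1)
      have := (hto (b.key u)).trichotomous ⟨u, rfl⟩ ⟨v, hk⟩
        (fun h => h1.2 ((hGiff _ ⟨u, rfl⟩ ⟨v, hk⟩).2 h))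
        (fun h => h2.2 ((hGiff _ ⟨v, hk⟩ ⟨u, rfl⟩).2 h))
      exact congrArg Subtype.val this
    · rcases h with h | h
      · exact lt_irrefl _ h
      · exact (hto (b.key u)).irrefl _ ((hGiff _ ⟨u, rfl⟩ ⟨u, rfl⟩).1 h)
    · rcases h1 with h1 | h1 <;> rcases h2 with h2 | h2
      · exact Or.inl (h1.trans h2)
      · exact Or.inl (hG' _ _ h2 ▸ h1)
      · exact Or.inl (hG' _ _ h1 ▸ h2)
      · have e1 := hG' _ _ h1
        have e2 := (hG' _ _ h2).trans e1
        exact Or.inr ((hGiff _ ⟨u, rfl⟩ ⟨w, e2⟩).2 ((hto (b.key u)).trans _ ⟨v, e1⟩ _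
          ((hGiff _ ⟨u, rfl⟩ ⟨v, e1⟩).1 h1) ((hGiff _ ⟨v, e1⟩ ⟨w, e2⟩).1 h2)))
  refine ⟨fun u v => b.key u < b.key v ∨ G u v,
    (((b.udef_key_lt hE).mono (by omega)).or
      (hG.mono (d' := 14 * M + 4 * d + 58) (by omega))), hsto, ?_⟩
  classical
  intro v
  obtain ⟨g₀, hg₀⟩ := hcut (b.key v) ⟨v, rfl⟩
  let X : V → Prop := fun x => (b.key x < b.key v ∨ G x v) ∨ x = v
  have hX : ∀ x, X x → b.key x ≤ b.key v := by
    rintro x ((h | h) | rfl)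
    exacts [h.le, (hG' _ _ h).ge, le_rfl]
  -- Only vertices in the last block of their type before the cut can contradict a prediction across
  -- it; for all others the type determines the row.
  let top : V → Prop := fun x => ∀ z, X z → b.ty z = b.ty x → b.blk z ≤ b.blk x
  let g : V → Fin M × Option (Fin K × Option (Fin N)) := fun x =>
    (b.ty x, if top x then
      some (b.near x, if h : b.key x = b.key v then some (g₀ ⟨x, h⟩) else none) else none)
  have hcard : Fintype.card (Fin M × Option (Fin K × Option (Fin N))) =
      M * (1 + K * (1 + N)) := by
    simp [Fintype.card_prod, Fintype.card_option, add_comm]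
  refine ⟨fun x => Fintype.equivFinOfCardEq hcard (g x), fun x x' hx hx' hg y hy => ?_⟩
  have hxX : X x := hx
  have hxX' : X x' := hx'
  have hg := (Fintype.equivFinOfCardEq hcard).injective hg
  have ht : b.ty x = b.ty x' := congrArg Prod.fst hg
  have hg2 := congrArg Prod.snd hg
  simp only [g] at hg2
  have hvy : b.key v ≤ b.key y := by
    rcases hy with h | h
    exacts [h.le, (hG' _ _ h).ge]
  have hxy : ∀ x, X x → x ≠ y := by
    rintro x (h | rfl) rfl
    · exact hsto.irrefl _ (hsto.trans _ _ _ h hy)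
    · exact hsto.irrefl _ hy
  have htop : ∀ x, X x → b.Ev y x → top x := fun x hx h z hz hzx =>
    b.blk_le_of_ev h hzx ((hX z hz).trans hvy)
  by_cases h : top x
  · by_cases h' : top x'
    swap
    · simp [h, h'] at hg2
    simp only [h, h', if_true, Option.some.injEq, Prod.mk.injEq] at hg2
    -- A type has only one last block before the cut, so `x` and `x'` share it.
    have hb : b.blk x = b.blk x' :=
      le_antisymm (h' x hxX ht) (h x' hxX' ht.symm)
    rcases le_or_gt (b.blk x + 2) (b.blk y) with hfar | hfar
    · rw [hE x y (hxy x hxX), hE x' y (hxy x' hxX'), b.far y x hfar, b.far y x' (hb ▸ hfar), ht]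
    rcases le_or_gt (b.blk y + 2) (b.blk x) with hfar' | hfar'
    · rw [b.far x y hfar', b.far x' y (hb ▸ hfar'), ht]
    by_cases hy' : b.blk y = b.blk x
    swap
    · exact b.adjacent x x' hb hg2.1 y (by omega)
    by_cases hk : b.key y = b.key x
    swap
    · exact b.edge_iff_of_key_ne hE ht hb hy' hk
    have hxv : b.key x = b.key v := le_antisymm (hX x hxX) (hvy.trans hk.le)
    by_cases hxv' : b.key x' = b.key v
    swap
    · simp [hxv, hxv'] at hg2
    simp only [hxv, hxv', dite_true, Option.some.injEq] at hg2
    have hXR : ∀ (x : V) (hk : b.key x = b.key v), X x →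
        R (b.key v) ⟨x, hk⟩ ⟨v, rfl⟩ ∨ (⟨x, hk⟩ : {w // b.key w = b.key v}) = ⟨v, rfl⟩ := by
      rintro x hk ((h | h) | h)
      · exact absurd hk h.ne
      · exact Or.inl ((hGiff _ ⟨x, hk⟩ ⟨v, rfl⟩).1 h)
      · exact Or.inr (Subtype.ext h)
    have hyv : b.key y = b.key v := hk.trans hxv
    refine hg₀ ⟨x, hxv⟩ ⟨x', hxv'⟩ (hXR x hxv hxX) (hXR x' hxv' hxX') hg2.2 ⟨y, hyv⟩ ?_
    rcases hy with hy | hy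
    · exact absurd hyv hy.ne'
    · exact (hGiff _ ⟨v, rfl⟩ ⟨y, hyv⟩).1 hy
  · by_cases h' : top x'
    · simp [h, h'] at hg2
    have e := mt (htop x hxX) h
    have e' := mt (htop x' hxX') h'
    unfold Ev at e e'
    rw [not_not] at e e'
    rw [hE x y (hxy x hxX), hE x' y (hxy x' hxX'), e, e', ht]

end Blocks

/-! ### Vertex sequences with few rows -/

theorem HasDefinableOrder.of_subsingleton {V : Type*} [Subsingleton V] (E : V → V → Prop) (d : ℕ)
    {N : ℕ} (hN : 0 < N) : HasDefinableOrder E d N :=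
  ⟨fun _ _ => False, UDef.false' d,
    { trichotomous := fun a b _ _ => Subsingleton.elim a b
      irrefl := fun _ h => h
      trans := fun _ _ _ h _ => h },
    fun _ => ⟨fun _ => ⟨0, hN⟩, fun _ _ _ _ _ _ h => h.elim⟩⟩

/-- At each time `t`, the vertices before `t` have at most `s + m` different rows on the vertices
from `t` on, where the labels below `s` stand for the rows given by the sets `S`. -/
def FewRows {V : Type*} (E : V → V → Prop) (pos : V → ℕ) (S : ℕ → Set V) (s m : ℕ) : Prop :=
  ∀ t, ∃ g : V → ℕ, (∀ x, g x < s + m) ∧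
    (∀ x, pos x < t → g x < s → ∀ y, t ≤ pos y → (E x y ↔ y ∈ S (g x))) ∧
    ∀ x x', pos x < t → pos x' < t → g x = g x' → ∀ y, t ≤ pos y → (E x y ↔ E x' y)

namespace FewRows

variable {V : Type*} (E : V → V → Prop) (pos : V → ℕ) (S : ℕ → Set V) (s : ℕ)

/-! ### Closing times and the blocks they cut out -/

/-- From time `t` on, the row of `x` is one of the sets `S`. -/
def Closed (x : V) (t : ℕ) : Prop := ∃ j < s, ∀ y, t ≤ pos y → (E x y ↔ y ∈ S j)

theorem Closed.mono {x : V} {t t' : ℕ} (h : Closed E pos S s x t) (ht : t ≤ t') :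
    Closed E pos S s x t' := by
  obtain ⟨j, hj, hy⟩ := h
  exact ⟨j, hj, fun y hty => hy y (ht.trans hty)⟩

/-- Beyond the last position the condition on the row is empty, so any known set will do. This is
where `0 < s` is needed. -/
theorem exists_next [Finite V] (hs : 0 < s) (t : ℕ) :
    ∃ t', t < t' ∧ ∀ x, pos x < t → Closed E pos S s x t' := by
  obtain ⟨n, hn⟩ := (Set.finite_range pos).bddAbove
  refine ⟨max t n + 1, by omega, fun x _ => ⟨0, hs, fun y hy => ?_⟩⟩
  have := hn ⟨y, rfl⟩
  omega

open Classical in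
/-- The first time after `t` at which all vertices before `t` are closed. -/
noncomputable def next [Finite V] (hs : 0 < s) (t : ℕ) : ℕ := Nat.find (exists_next E pos S s hs t)

/-- The sequence of the starting times of the blocks. -/
noncomputable def cut [Finite V] (hs : 0 < s) (j : ℕ) : ℕ := (next E pos S s hs)^[j] 0

variable [Finite V] (hs : 0 < s)

theorem cut_succ (j : ℕ) : cut E pos S s hs (j + 1) = next E pos S s hs (cut E pos S s hs j) :=
  Function.iterate_succ_apply' _ _ _

theorem cut_lt (j : ℕ) : cut E pos S s hs j < cut E pos S s hs (j + 1) := by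
  classical
  rw [cut_succ]
  exact (Nat.find_spec (exists_next E pos S s hs _)).1

theorem cut_strictMono : StrictMono (cut E pos S s hs) :=
  strictMono_nat_of_lt_succ (cut_lt E pos S s hs)

theorem closed_cut {j : ℕ} {x : V} (hx : pos x < cut E pos S s hs j) :
    Closed E pos S s x (cut E pos S s hs (j + 1)) := by
  classical
  rw [cut_succ]
  exact (Nat.find_spec (exists_next E pos S s hs _)).2 x hx

/-- Minimality of the next cut. It yields the vertex whose row becomes a new known set in
`restrict`. -/
theorem exists_not_closed {j t : ℕ} (h : cut E pos S s hs j < t)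
    (h' : t < cut E pos S s hs (j + 1)) :
    ∃ x, pos x < cut E pos S s hs j ∧ ¬ Closed E pos S s x t := by
  classical
  rw [cut_succ] at h'
  have := Nat.find_min (exists_next E pos S s hs _) h'
  push Not at this
  exact this h

theorem exists_lt_cut (v : V) : ∃ j, pos v < cut E pos S s hs (j + 1) :=
  ⟨pos v, (Nat.lt_succ_self _).trans_le ((cut_strictMono E pos S s hs).le_apply)⟩

open Classical in
/-- The number of the block of a vertex. -/
noncomputable def block (v : V) : ℕ := Nat.find (exists_lt_cut E pos S s hs v)

theorem lt_cut (v : V) : pos v < cut E pos S s hs (block E pos S s hs v + 1) := by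
  classical
  exact Nat.find_spec (exists_lt_cut E pos S s hs v)

theorem cut_le (v : V) : cut E pos S s hs (block E pos S s hs v) ≤ pos v := by
  classical
  rcases h : block E pos S s hs v with _ | j
  · exact Nat.zero_le _
  · exact not_lt.1 (Nat.find_min (exists_lt_cut E pos S s hs v) (m := j)
      (by rw [show Nat.find _ = _ from h]; exact j.lt_succ_self))

variable {E pos S s}

/-- The block structure of a vertex sequence with few rows. -/
theorem exists_blocks (hE : ∀ u v, u ≠ v → (E u v ↔ ¬ E v u)) {m K : ℕ} (hK : s + m ≤ K)
    (h : FewRows E pos S s m) :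
    ∃ b : Blocks E (K * 2 ^ K * 3) (K * 2 ^ K), b.blk = block E pos S s hs := by
  classical
  set c := cut E pos S s hs with hc
  set β := block E pos S s hs with hβ
  have hlt : ∀ v, pos v < c (β v + 1) := lt_cut E pos S s hs
  have hle : ∀ v, c (β v) ≤ pos v := cut_le E pos S s hs
  have hmono : Monotone c := (cut_strictMono E pos S s hs).monotone
  choose α hα hαS using fun v => closed_cut E pos S s hs (hlt v)
  choose g hg hgS hgr using h
  have e1 : Fintype.card (Fin K × Set (Fin K) × Fin 3) = K * 2 ^ K * 3 := by
    simp [Fintype.card_prod, mul_assoc]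
  have e2 : Fintype.card (Fin K × Set (Fin K)) = K * 2 ^ K := by
    simp [Fintype.card_prod]
  -- The known set that is the row of `v` from two blocks later on, the known sets containing `v`,
  -- and the residue of its block.
  let t₀ : V → Fin K × Set (Fin K) × Fin 3 := fun v =>
    (⟨α v, by have := hα v; omega⟩, {j | v ∈ S j}, Fin.ofNat 3 (β v))
  -- Towards the next block the row is given by the label at the end of the block of `x`. Towards
  -- the previous block it is given by the labels, at the start of that block, of the earlier
  -- vertices with an edge to `x`.
  let n₀ : V → Fin K × Set (Fin K) := fun x =>
    (⟨g (c (β x + 1)) x, by have := hg (c (β x + 1)) x; omega⟩,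
      {j | ∃ y, pos y < c (β x) ∧ g (c (β x)) y = j ∧ E y x})
  have hne : ∀ {u v}, β v ≠ β u → u ≠ v := fun h h' => h (by rw [h'])
  refine ⟨{ blk := β
            ty := fun v => Fintype.equivFinOfCardEq e1 (t₀ v)
            back := fun p q =>
              ((Fintype.equivFinOfCardEq e1).symm q).1 ∉ ((Fintype.equivFinOfCardEq e1).symm p).2.1
            near := fun v => Fintype.equivFinOfCardEq e2 (n₀ v)
            far := fun u v huv => ?_
            residue := fun u v huv => ?_
            adjacent := fun x x' hxx hn y hy => ?_ }, rfl⟩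
  · have h1 : c (β v + 1 + 1) ≤ pos u := (hmono huv).trans (hle u)
    rw [hE u v (hne (by omega)), hαS v u h1]
    simp [t₀]
  · have h1 := (Fintype.equivFinOfCardEq e1).injective huv
    have h2 := congrArg (fun p => p.2.2.1) h1
    simpa [t₀] using h2
  · have h1 := (Fintype.equivFinOfCardEq e2).injective hn
    have h2 := congrArg (fun p => p.1.1) h1
    have h3 := congrArg (fun p => p.2) h1
    simp only [n₀, ← hxx] at h2 h3
    rcases hy with hy | hy
    · exact hgr _ x x' (hlt x) (hxx ▸ hlt x') h2 y (hy ▸ hle y)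
    · have hyx : pos y < c (β x) := hy ▸ hlt y
      have key : ∀ z z', c (β x) ≤ pos z → c (β x) ≤ pos z' →
          {j : Fin K | ∃ y, pos y < c (β x) ∧ g (c (β x)) y = j ∧ E y z} =
            {j : Fin K | ∃ y, pos y < c (β x) ∧ g (c (β x)) y = j ∧ E y z'} →
          E y z → E y z' := by
        intro z z' hz hz' he hyz
        have hK' : g (c (β x)) y < K := by have := hg (c (β x)) y; omega
        have hmem : (⟨g (c (β x)) y, hK'⟩ : Fin K) ∈
            {j : Fin K | ∃ y, pos y < c (β x) ∧ g (c (β x)) y = j ∧ E y z} := ⟨y, hyx, rfl, hyz⟩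
        rw [he] at hmem
        obtain ⟨w, hw, hwg, hwE⟩ := hmem
        exact (hgr _ w y hw hyx hwg z' hz').1 hwE
      rw [hE x y (hne (by omega)), hE x' y (hne (by omega)), not_iff_not]
      exact ⟨key x x' (hle x) (hxx ▸ hle x') h3, key x' x (hxx ▸ hle x') (hle x) h3.symm⟩

/-- A set of vertices inside one block is trivial, or has fewer rows apart from those given by an
enlarged family of sets. -/
theorem restrict (hpos : pos.Injective) {m : ℕ} (h : FewRows E pos S s m) {t : Set V}
    (ht : ∀ x ∈ t, ∀ y ∈ t, block E pos S s hs x = block E pos S s hs y) :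
    Subsingleton t ∨ ∃ m' S', m = m' + 1 ∧
      FewRows (fun x y : t => E x y) (fun x => pos x) S' (s + 1) m' := by
  classical
  rcases Set.eq_empty_or_nonempty t with rfl | ⟨v, hv⟩
  · exact Or.inl inferInstance
  set c := cut E pos S s hs with hc
  set a := block E pos S s hs v with ha
  have hlt : ∀ x ∈ t, pos x < c (a + 1) := fun x hx => by
    rw [ha, ht v hv x hx]; exact lt_cut E pos S s hs x
  have hle : ∀ x ∈ t, c a ≤ pos x := fun x hx => by
    rw [ha, ht v hv x hx]; exact cut_le E pos S s hs x
  -- A block that is one time step long contains at most one vertex, since `pos` is injective.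
  rcases (Nat.succ_le_of_lt (cut_lt E pos S s hs a)).eq_or_lt with h1 | h1
  · refine Or.inl ⟨fun x y => Subtype.ext (hpos ?_)⟩
    have h2 := hlt x x.2
    have h3 := hlt y y.2
    have h4 := hle x x.2
    have h5 := hle y y.2
    change c a + 1 = c (a + 1) at h1
    omega
  change c a + 1 < c (a + 1) at h1
  right
  -- Not closed one step before the end of the block, `x₀` is not closed at any earlier time, so
  -- inside the block its label is never below `s`.
  obtain ⟨x₀, hx₀, hnc⟩ := exists_not_closed E pos S s hs (j := a) (t := c (a + 1) - 1)
    (by change c a < _; omega) (by change _ < c (a + 1); omega)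
  change pos x₀ < c a at hx₀
  have hopen : ∀ t, t ≤ c (a + 1) - 1 → ∀ g : V → ℕ,
      (∀ x, pos x < t → g x < s → ∀ y, t ≤ pos y → (E x y ↔ y ∈ S (g x))) → c a < t →
        s ≤ g x₀ := by
    intro t ht g hg hct
    by_contra hlt
    exact hnc (Closed.mono E pos S s ⟨g x₀, not_le.1 hlt, hg x₀ (hx₀.trans hct) (not_le.1 hlt)⟩ ht)
  obtain ⟨m, rfl⟩ : ∃ m', m = m' + 1 := by
    refine Nat.exists_eq_succ_of_ne_zero fun hm => ?_
    subst hm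
    obtain ⟨g, hg, hgS, -⟩ := h (c (a + 1) - 1)
    have := hopen _ le_rfl g hgS (by omega)
    have := hg x₀
    omega
  -- The row of `x₀` becomes the known set with number `s`. At each time, exchanging the label `s`
  -- with the label of `x₀` makes the labels fit.
  refine ⟨m, fun j => {y | if j = s then E x₀ y else (y : V) ∈ S j}, rfl, fun t' => ?_⟩
  by_cases hcase : c a < t' ∧ t' ≤ c (a + 1) - 1
  swap
  -- At any other time the cut does not separate two vertices of `t`.
  · have hvac : ∀ x y : t, pos x < t' → ¬ t' ≤ pos y := fun x y hx hy => by
      have h2 := hlt y y.2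
      have h3 := hle x x.2
      omega
    exact ⟨fun _ => 0, fun _ => by dsimp only; omega, fun x hx _ y hy => absurd hy (hvac x y hx),
      fun x _ hx _ _ y hy => absurd hy (hvac x y hx)⟩
  obtain ⟨g, hg, hgS, hgr⟩ := h t'
  have hx₀s := hopen t' hcase.2 g hgS hcase.1
  have hx₀t : pos x₀ < t' := hx₀.trans hcase.1
  refine ⟨fun x => Equiv.swap s (g x₀) (g x), fun x => ?_, fun x hx hxs y hy => ?_,
    fun x x' hx hx' hxx y hy => hgr x x' hx hx' ((Equiv.swap s (g x₀)).injective hxx) y hy⟩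
  · have h2 := hg x
    have h3 := hg x₀
    change Equiv.swap s (g x₀) (g x) < _
    rw [Equiv.swap_apply_def]
    split_ifs <;> omega
  · by_cases hxg : g x = g x₀
    · simp only [hxg, Equiv.swap_apply_right, Set.mem_ofPred_eq, if_true]
      exact hgr x x₀ hx hx₀t hxg y hy
    · have hlt' : g x < s := by
        change Equiv.swap s (g x₀) (g x) < _ at hxs
        rw [Equiv.swap_apply_def] at hxs
        split_ifs at hxs <;> omega
      have h5 : Equiv.swap s (g x₀) (g x) = g x := Equiv.swap_apply_of_ne_of_ne hlt'.ne hxg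
      simp only [h5, Set.mem_ofPred_eq, if_neg hlt'.ne]
      exact hgS x hx hlt' y hy

end FewRows

/-- The depth of the universal formula for sequences with `m` new rows and `K` rows. -/
def depthBound (K : ℕ) : ℕ → ℕ
  | 0 => 0
  | m + 1 => 14 * (K * 2 ^ K * 3) + 4 * depthBound K m + 60

/-- The number of rows in the definable ordering of a sequence with `m` new rows and `K` rows. -/
def rowBound (K : ℕ) : ℕ → ℕ
  | 0 => 1
  | m + 1 => K * 2 ^ K * 3 * (1 + K * 2 ^ K * (1 + rowBound K m))

theorem rowBound_pos {K : ℕ} (hK : 0 < K) : ∀ m, 0 < rowBound K m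
  | 0 => Nat.one_pos
  | m + 1 => by unfold rowBound; positivity

/-- Induction on the number of unknown rows. Passing to a block moves one row from unknown to known,
so a single `K` bounds `s + m` throughout; at `m = 0` every block is trivial. -/
theorem FewRows.hasDefinableOrder {K : ℕ} (m : ℕ) : ∀ {V : Type u} [Fintype V] {E : V → V → Prop}
    (_ : ∀ u v, u ≠ v → (E u v ↔ ¬ E v u)) {pos : V → ℕ} (_ : pos.Injective)
    {S : ℕ → Set V} {s : ℕ} (_ : 0 < s) (_ : s + m ≤ K) (_ : FewRows E pos S s m),
    HasDefinableOrder E (depthBound K (m + 1)) (rowBound K (m + 1)) := by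
  induction m with
  | zero =>
    intro V _ E hE pos hpos S s hs hK h
    obtain ⟨b, hb⟩ := FewRows.exists_blocks hs hE hK h
    refine b.hasDefinableOrder hE fun t ht => ?_
    rw [hb] at ht
    rcases FewRows.restrict hs hpos h ht with h | ⟨m', _, h, -⟩
    · exact .of_subsingleton _ _ Nat.one_pos
    · omega
  | succ m ih =>
    intro V _ E hE pos hpos S s hs hK h
    obtain ⟨b, hb⟩ := FewRows.exists_blocks hs hE hK h
    refine b.hasDefinableOrder hE fun t ht => ?_
    rw [hb] at ht
    rcases FewRows.restrict hs hpos h ht with h | ⟨m', S', hm, h⟩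
    · exact .of_subsingleton _ _ (rowBound_pos (by omega) _)
    · obtain rfl : m = m' := by omega
      classical
      exact ih (fun u v huv => hE u v fun h => huv (Subtype.ext h))
        (hpos.comp Subtype.val_injective) (Nat.succ_pos s) (by omega) h

/-! ### Linear NLC-width -/

/-- A vertex sequence for a labelled digraph of the class `LinearNLC`, with few rows. -/
theorem LinearNLC.exists_pos {k : ℕ} {V : Type u} {T : Digraph V} {lab : V → Fin k}
    (h : LinearNLC k T lab) : ∃ (pos : V → ℕ) (n : ℕ), pos.Injective ∧ (∀ v, pos v < n) ∧
      ∀ t, ∃ l : V → Fin k, ∀ x x', pos x < t → pos x' < t → l x = l x' →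
        lab x = lab x' ∧ ∀ y, t ≤ pos y → (T.Adj x y ↔ T.Adj x' y) := by
  induction h with
  | empty T lab =>
    exact ⟨fun _ => 0, 0, fun x => isEmptyElim x, isEmptyElim,
      fun _ => ⟨lab, fun x => isEmptyElim x⟩⟩
  | @vertexAddition V T lab X c _ ih =>
    obtain ⟨pos, n, hinj, hlt, hrow⟩ := ih
    refine ⟨fun v => v.elim n pos, n + 1, ?_, ?_, fun t => ?_⟩
    · rintro (_ | u) (_ | v) huv
      · rfl
      · exact absurd huv (hlt v).ne'
      · exact absurd huv (hlt u).ne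
      · exact congrArg some (hinj huv)
    · rintro (_ | v)
      · exact n.lt_succ_self
      · exact (hlt v).trans n.lt_succ_self
    · rcases le_or_gt t n with ht | ht
      · obtain ⟨l, hl⟩ := hrow t
        refine ⟨fun v => v.elim c l, ?_⟩
        rintro (_ | x) (_ | x') hx hx' hxx
        · exact absurd hx (not_lt.2 ht)
        · exact absurd hx (not_lt.2 ht)
        · exact absurd hx' (not_lt.2 ht)
        · obtain ⟨h1, h2⟩ := hl x x' hx hx' hxx
          refine ⟨h1, ?_⟩
          rintro (_ | y) hy
          -- The equality of current labels is part of the induction because it decides the edges to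
          -- the vertex being added.
          · change lab x ∈ X ↔ lab x' ∈ X
            rw [h1]
          · exact h2 y hy
      · refine ⟨fun v => v.elim c lab, fun x x' _ _ hxx => ⟨hxx, ?_⟩⟩
        rintro (_ | y) hy
        · exact absurd hy (not_le.2 ht)
        · exact absurd hy (not_le.2 ((hlt y).trans ht))
  | relabelling ρ _ ih =>
    obtain ⟨pos, n, hinj, hlt, hrow⟩ := ih
    refine ⟨pos, n, hinj, hlt, fun t => ?_⟩
    obtain ⟨l, hl⟩ := hrow t
    refine ⟨l, fun x x' hx hx' hxx => ?_⟩
    obtain ⟨h1, h2⟩ := hl x x' hx hx' hxx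
    exact ⟨congrArg ρ h1, h2⟩
  | iso e T' hT _ ih =>
    obtain ⟨pos, n, hinj, hlt, hrow⟩ := ih
    refine ⟨pos ∘ e, n, hinj.comp e.injective, fun v => hlt (e v), fun t => ?_⟩
    obtain ⟨l, hl⟩ := hrow t
    refine ⟨l ∘ e, fun x x' hx hx' hxx => ?_⟩
    obtain ⟨h1, h2⟩ := hl (e x) (e x') hx hx' hxx
    refine ⟨h1, fun y hy => ?_⟩
    rw [hT, hT]
    exact h2 (e y) hy

/-- Tournaments of bounded linear NLC-width have a definable ordering with few rows. -/
theorem IsTournament.hasDefinableOrder {k : ℕ} {V : Type u} [Fintype V] {T : Digraph V}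
    (hT : IsTournament T) (hk : linearNLCWidth T ≤ k) :
    HasDefinableOrder T.Adj (depthBound (k + 1) (k + 1)) (rowBound (k + 1) (k + 1)) := by
  obtain ⟨k₀, hk₀, lab, hl⟩ : ∃ k₀ ≤ k, ∃ lab : V → Fin k₀, LinearNLC k₀ T lab := by
    by_contra! hc
    refine absurd hk (not_le.2 (lt_of_lt_of_le (b := ((k + 1 : ℕ) : ℕ∞)) ?_ ?_))
    · exact_mod_cast k.lt_succ_self
    · refine le_iInf₂ fun j ⟨lab, hj⟩ => ?_
      have : k < j := not_le.1 fun h => hc j h lab hj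
      exact_mod_cast this
  obtain ⟨pos, -, hinj, -, hrow⟩ := hl.exists_pos
  -- The empty set serves as a dummy known row, because `s` has to be positive; the real labels are
  -- shifted by one and never use the label 0.
  refine FewRows.hasDefinableOrder (S := fun _ => ∅) (s := 1) k (fun u v huv => ?_) hinj
    Nat.one_pos (by omega) fun t => ?_
  · rcases hT.2 u v huv with h | h <;> simp [h]
  · obtain ⟨l, hl⟩ := hrow t
    refine ⟨fun x => 1 + l x, fun x => by have := (l x).2; dsimp only; omega,
      fun x _ hx => by dsimp only at hx; omega, fun x x' hx hx' hxx => ?_⟩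
    exact (hl x x' hx hx' (Fin.ext (by simpa using hxx))).2

/-! ### Cut-rank and representatives of rows -/

/-- The row space is spanned by one row for each value of `g`. -/
theorem rankBetween_le {V : Type u} [Fintype V] (G : Digraph V) {X Y : Set V} {ι : Type*}
    [Fintype ι] (g : X → ι)
    (hg : ∀ x x' : X, g x = g x' → ∀ y ∈ Y, (G.Adj x y ↔ G.Adj x' y)) :
    rankBetween G X Y ≤ Fintype.card ι := by
  classical
  unfold rankBetween
  rw [Matrix.rank_eq_finrank_span_row]
  set A : Matrix X Y (ZMod 2) := Matrix.of fun x y => if G.Adj x y then 1 else 0 with hA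
  let r : ι → Y → ZMod 2 := fun i => if h : ∃ x, g x = i then A h.choose else 0
  have hr : ∀ x, A x = r (g x) := by
    intro x
    have h : ∃ x', g x' = g x := ⟨x, rfl⟩
    funext y
    simp only [r, dif_pos h, hA, Matrix.of_apply, hg _ _ h.choose_spec y y.2]
  refine (Submodule.finrank_mono (Submodule.span_mono ?_)).trans (finrank_range_le_card r)
  rintro _ ⟨x, rfl⟩
  exact ⟨g x, (hr x).symm⟩

/-! ### Counting rows by their first representatives -/

/-- `x` is the first vertex before the cut at `v` with its row. -/
def IsRep {V : Type u} (E lt : V → V → Prop) (v x : V) : Prop :=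
  (lt x v ∨ x = v) ∧ ∀ x', lt x' x → ¬ ∀ y, lt v y → (E x y ↔ E x' y)

/-- Repeated removal of the first element of each set `C v`. -/
def dropFirst {V : Type u} (lt : V → V → Prop) (C : V → V → Prop) : ℕ → V → V → Prop
  | 0, v, x => C v x
  | n + 1, v, x => dropFirst lt C n v x ∧ ∃ x', lt x' x ∧ dropFirst lt C n v x'

section
variable {V : Type u} {lt : V → V → Prop} [IsStrictTotalOrder V lt] {C : V → V → Prop}

/-- A round removes at most one element: of two removed elements, the smaller would keep the larger
one in the set. -/
theorem ncard_le_of_dropFirst [Finite V] {v : V} {n : ℕ} (h : ∀ x, ¬ dropFirst lt C n v x) :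
    {x | C v x}.ncard ≤ n := by
  have key : ∀ m, {x | C v x}.ncard ≤ {x | dropFirst lt C m v x}.ncard + m := by
    intro m
    induction m with
    | zero => exact le_rfl
    | succ m ih =>
      refine ih.trans ?_
      have hsub : ({x | dropFirst lt C m v x} \ {x | dropFirst lt C (m + 1) v x}).ncard ≤ 1 := by
        refine (Set.ncard_le_one_iff (Set.toFinite _)).2 fun {a b} ha hb => ?_
        rcases trichotomous_of lt a b with h | h | h
        · exact absurd ⟨hb.1, a, h, ha.1⟩ hb.2
        · exact h
        · exact absurd ⟨ha.1, b, h, hb.1⟩ ha.2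
      have := Set.ncard_le_ncard_sdiff_add_ncard {x | dropFirst lt C m v x}
        {x | dropFirst lt C (m + 1) v x}
      omega
  have h0 : {x | dropFirst lt C n v x} = ∅ := Set.eq_empty_of_forall_notMem h
  have := key n
  rw [h0] at this
  simpa using this

/-- Each round removes the least element of a nonempty set, so `n` rounds exhaust a set of at most
`n` elements. -/
theorem not_dropFirst [Finite V] {v : V} {n : ℕ} (h : {x | C v x}.ncard ≤ n) (x : V) :
    ¬ dropFirst lt C n v x := by
  have key : ∀ m, {x | dropFirst lt C m v x}.ncard ≤ {x | C v x}.ncard - m := by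
    intro m
    induction m with
    | zero => exact le_rfl
    | succ m ih =>
      rcases Set.eq_empty_or_nonempty {x | dropFirst lt C m v x} with h0 | h0
      · have : {x | dropFirst lt C (m + 1) v x} = ∅ :=
          Set.eq_empty_of_subset_empty fun x hx => h0 ▸ hx.1
        simp [this]
      · obtain ⟨a, ha, hmin⟩ := (Finite.wellFounded_of_trans_of_irrefl lt).has_min _ h0
        have hlt : {x | dropFirst lt C (m + 1) v x}.ncard < {x | dropFirst lt C m v x}.ncard :=
          Set.ncard_lt_ncard ⟨fun x hx => hx.1, fun hs =>
            have ⟨x', hx', h'⟩ := (hs ha).2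
            hmin x' h' hx'⟩
        omega
  intro hx
  have h1 := key n
  have h2 : 0 < {x | dropFirst lt C n v x}.ncard := (Set.ncard_pos (Set.toFinite _)).2 ⟨x, hx⟩
  omega

theorem exists_rep [Finite V] (E : V → V → Prop) {v x : V} (hx : lt x v ∨ x = v) :
    ∃ z, IsRep E lt v z ∧ ∀ y, lt v y → (E x y ↔ E z y) := by
  obtain ⟨z, ⟨hz, hzx⟩, hmin⟩ := (Finite.wellFounded_of_trans_of_irrefl lt).has_min
    {z | (lt z v ∨ z = v) ∧ ∀ y, lt v y → (E x y ↔ E z y)} ⟨x, hx, fun _ _ => Iff.rfl⟩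
  refine ⟨z, ⟨hz, fun x' hx' h => hmin x' ⟨?_, fun y hy => (hzx y hy).trans (h y hy)⟩ hx'⟩, hzx⟩
  rcases hz with hz | rfl
  exacts [Or.inl (trans_of lt hx' hz), Or.inl hx']

theorem cutRank_le [Fintype V] (G : Digraph V) {N : ℕ}
    (h : ∀ v x, ¬ dropFirst lt (IsRep G.Adj lt) N v x) : cutRank G lt ≤ N := by
  classical
  refine Finset.sup_le fun v _ => ?_
  have hN := ncard_le_of_dropFirst (h v)
  choose! r hr hrow using fun x (hx : lt x v ∨ x = v) => exists_rep G.Adj hx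
  refine (rankBetween_le G (ι := {z // IsRep G.Adj lt v z}) (fun x => ⟨r x, hr x x.2⟩)
    fun x x' hxx y hy => ?_).trans ?_
  · have hr' : r x = r x' := congrArg Subtype.val hxx
    rw [hrow x x.2 y hy, hrow x' x'.2 y hy, hr']
  · rw [← Nat.card_eq_fintype_card]
    exact hN

theorem CutClasses.ncard_isRep_le [Finite V] {E : V → V → Prop} {N : ℕ}
    (h : CutClasses E lt N) (v : V) : {x | IsRep E lt v x}.ncard ≤ N := by
  obtain ⟨g, hg⟩ := h v
  have := Set.ncard_le_ncard_of_injOn (s := {x | IsRep E lt v x}) (t := Set.univ) g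
    (fun _ _ => Set.mem_univ _) (fun a ha b hb hab => ?_) Set.finite_univ
  · simpa [Set.ncard_univ] using this
  · rcases trichotomous_of lt a b with h | h | h
    · exact absurd (hg b a hb.1 ha.1 hab.symm) (hb.2 a h)
    · exact h
    · exact absurd (hg a b ha.1 hb.1 hab) (ha.2 b h)

end

/-! ### Structures with binary relations -/

/-- The structure over a signature of binary symbols, given by a sequence of binary relations. -/
def binStructure {Γ : Signature} (hΓ : ∀ r ∈ Γ, r = 2) (V : Type u) (rel : ℕ → V → V → Prop) :
    RelStructure.{u} Γ :=
  RelStructure.ofRel V fun {r} R x =>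
    have hr : r = 2 := hΓ r (List.mem_of_getElem? R.2)
    rel R.1 (x ⟨0, by omega⟩) (x ⟨1, by omega⟩)

/-- Formulas for the symbols of a signature of binary symbols. -/
def binFormulas {Γ Δ : Signature} (hΔ : ∀ r ∈ Δ, r = 2) (φ : ℕ → Γ.lang.Formula (Fin 2)) {r : ℕ}
    (R : Δ.lang.Relations r) : Γ.lang.Formula (Fin r) :=
  (hΔ r (List.mem_of_getElem? R.2)).symm ▸ φ R.1

theorem outputs_binFormulas {Γ Δ : Signature} (hΔ : ∀ r ∈ Δ, r = 2)
    (φ : ℕ → Γ.lang.Formula (Fin 2)) (S : RelStructure.{u} Γ) :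
    (FOOp.interpretation Δ (binFormulas hΔ φ)).outputs S =
      {binStructure hΔ S.α fun i a b => (φ i).Realize ![a, b]} := by
  simp only [FOOp.outputs, binStructure]
  congr 2
  funext r R x
  have hr : r = 2 := hΔ r (List.mem_of_getElem? R.2)
  subst hr
  simp only [binFormulas]
  congr 1
  funext i
  fin_cases i <;> rfl

/-- An atomic formula with a binary symbol. -/
def relAtom {Γ : Signature} (i : ℕ) (h : Γ[i]? = some 2) {α : Type} {n : ℕ} (s t : α ⊕ Fin n) :
    Γ.lang.BoundedFormula α n :=
  .rel (⟨i, h⟩ : Γ.lang.Relations 2) ![.var s, .var t]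

/-- An equation between variables. -/
def eqAtom {Γ : Signature} {α : Type} {n : ℕ} (s t : α ⊕ Fin n) : Γ.lang.BoundedFormula α n :=
  .equal (.var s) (.var t)

theorem realize_eqAtom {Γ : Signature} {S : RelStructure.{u} Γ} {α : Type} {n : ℕ}
    (s t : α ⊕ Fin n) (v : α → S.α) (xs : Fin n → S.α) :
    (eqAtom s t : Γ.lang.BoundedFormula α n).Realize v xs ↔ Sum.elim v xs s = Sum.elim v xs t :=
  Iff.rfl

/-! ### The universal formula -/

/-- The signature of digraphs with `c` colours. -/
abbrev colSignature (c : ℕ) : Signature := graphSignature ++ List.replicate c 1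

open Classical in
/-- The atomic formula with a given colour. -/
noncomputable def colAtom {c : ℕ} (j : ℕ) {α : Type} {n : ℕ} (s : α ⊕ Fin n) :
    (colSignature c).lang.BoundedFormula α n :=
  if h : (colSignature c)[j + 1]? = some 1 then
    .rel (⟨j + 1, h⟩ : (colSignature c).lang.Relations 1) ![.var s] else .falsum

/-- The edge relation of a coloured digraph. -/
def colEdge {c : ℕ} (S : RelStructure.{u} (colSignature c)) (a b : S.α) : Prop :=
  S.Holds (⟨0, rfl⟩ : (colSignature c).lang.Relations 2) ![a, b]

/-- The colours of a coloured digraph. -/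
def colOf {c : ℕ} (S : RelStructure.{u} (colSignature c)) (j : ℕ) (a : S.α) : Prop :=
  ∃ h : (colSignature c)[j + 1]? = some 1,
    S.Holds (⟨j + 1, h⟩ : (colSignature c).lang.Relations 1) ![a]

/-- The universal formula. -/
noncomputable def univFormula {c : ℕ} :
    ℕ → ℕ → {n : ℕ} → Fin 2 ⊕ Fin n → Fin 2 ⊕ Fin n →
      (colSignature c).lang.BoundedFormula (Fin 2) n
  | 0, o, _, s, t =>
      ((colAtom (3 * o) s).imp ((relAtom 0 rfl s t).imp .falsum)).imp
        (((colAtom (3 * o + 1) s).imp ((eqAtom s t).imp .falsum)).imp (colAtom (3 * o + 2) s))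
  | d + 1, o, n, s, t =>
      (((colAtom (3 * o) s).imp
        ((univFormula d (o + 1) s t).imp (univFormula d (o + 1 + nodeCount d) s t))).imp
      (((colAtom (3 * o + 1) s).imp
        (.all ((univFormula d (o + 1) (s.map id Fin.castSucc) (.inr (Fin.last n))).imp
          (univFormula d (o + 1 + nodeCount d) (.inr (Fin.last n)) (t.map id Fin.castSucc))))).imp
      (((colAtom (3 * o + 2) s).imp (univFormula d (o + 1) t s)).imp .falsum))).imp .falsum

theorem realize_colAtom {c : ℕ} {S : RelStructure.{u} (colSignature c)} (j : ℕ) {α : Type} {n : ℕ}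
    (s : α ⊕ Fin n) (v : α → S.α) (xs : Fin n → S.α) :
    (colAtom j s : (colSignature c).lang.BoundedFormula α n).Realize v xs ↔
      colOf S j (Sum.elim v xs s) := by
  unfold colAtom colOf
  split_ifs with h
  · have hs : (fun i => (![(.var s : (colSignature c).lang.Term (α ⊕ Fin n))] i).realize
        (Sum.elim v xs)) = ![Sum.elim v xs s] := by
      funext i; fin_cases i; rfl
    refine ⟨fun hr => ⟨h, ?_⟩, fun ⟨_, hr⟩ => ?_⟩
    · rw [← hs]; exact hr
    · rw [← hs] at hr; exact hr
  · exact ⟨fun hr => hr.elim, fun ⟨h', _⟩ => h h'⟩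

theorem realize_univFormula {c : ℕ} {S : RelStructure.{u} (colSignature c)} (d : ℕ) :
    ∀ (o : ℕ) {n : ℕ} (s t : Fin 2 ⊕ Fin n) (v : Fin 2 → S.α) (xs : Fin n → S.α),
      (univFormula d o s t : (colSignature c).lang.BoundedFormula (Fin 2) n).Realize v xs ↔
        univRel (colEdge S) (colOf S) d o (Sum.elim v xs s) (Sum.elim v xs t) := by
  have hsnoc : ∀ {n : ℕ} (s : Fin 2 ⊕ Fin n) (v : Fin 2 → S.α) (xs : Fin n → S.α) (z : S.α),
      Sum.elim v (Fin.snoc xs z) (s.map id Fin.castSucc) = Sum.elim v xs s := by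
    rintro n (s | s) v xs z <;> simp
  have hE : ∀ {n : ℕ} (s t : Fin 2 ⊕ Fin n) (v : Fin 2 → S.α) (xs : Fin n → S.α),
      (relAtom 0 rfl s t : (colSignature c).lang.BoundedFormula (Fin 2) n).Realize v xs ↔
        colEdge S (Sum.elim v xs s) (Sum.elim v xs t) := by
    intro n s t v xs
    refine iff_of_eq (congrArg (S.str.RelMap _) (funext fun i => ?_))
    fin_cases i <;> rfl
  induction d with
  | zero =>
    intro o n s t v xs
    simp only [univFormula, univRel, FirstOrder.Language.BoundedFormula.realize_imp, realize_colAtom,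
      hE, realize_eqAtom, FirstOrder.Language.BoundedFormula.Realize]
    tauto
  | succ d ih =>
    intro o n s t v xs
    simp only [univFormula, univRel, FirstOrder.Language.BoundedFormula.realize_imp, realize_colAtom,
      ih, hsnoc, FirstOrder.Language.BoundedFormula.Realize, Sum.elim_inr, Fin.snoc_last]
    tauto

/-! ### The transduction -/

/-- The signature of ordered digraphs with an additional binary symbol. -/
abbrev tripleSignature : Signature := [2, 2, 2]

theorem eq_two_of_mem_ordered : ∀ r ∈ orderedGraphSignature, r = 2 := by simp

theorem eq_two_of_mem_triple : ∀ r ∈ tripleSignature, r = 2 := by simp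

/-- The sequence of binary relations that starts with `E`, `lt`. -/
def pairRel {V : Type u} (E lt : V → V → Prop) : ℕ → V → V → Prop
  | 0 => E
  | _ => lt

/-- The sequence of binary relations that starts with `E`, `lt`, `C`. -/
def tripleRel {V : Type u} (E lt C : V → V → Prop) : ℕ → V → V → Prop
  | 0 => E
  | 1 => lt
  | _ => C

theorem orderedGraphStructure_eq {V : Type u} (G : Digraph V) (lt : V → V → Prop) :
    orderedGraphStructure G lt = binStructure eq_two_of_mem_ordered V (pairRel G.Adj lt) := by
  unfold orderedGraphStructure binStructure
  congr 1
  funext r R x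
  obtain ⟨_ | i, h⟩ := R <;> rfl

/-- The definition of the edge relation and of the ordering by the universal formula. -/
noncomputable def orderFormulas (c d : ℕ) : ℕ → (colSignature c).lang.Formula (Fin 2)
  | 0 => relAtom 0 rfl (.inl 0) (.inl 1)
  | _ => univFormula d 0 (.inl 0) (.inl 1)

/-- The sentence that says that the second relation is a strict linear ordering. -/
def linearSentence : orderedGraphSignature.lang.Sentence :=
  (.all ((relAtom 1 rfl (.inr 0) (.inr 0)).imp .falsum) :
    orderedGraphSignature.lang.BoundedFormula Empty 0) ⊓
  (.all (.all (.all ((relAtom 1 rfl (.inr 0) (.inr 1)).imp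
    ((relAtom 1 rfl (.inr 1) (.inr 2)).imp (relAtom 1 rfl (.inr 0) (.inr 2)))))) ⊓
  .all (.all (((relAtom 1 rfl (.inr 0) (.inr 1)).imp .falsum).imp
    (((relAtom 1 rfl (.inr 1) (.inr 0)).imp .falsum).imp (eqAtom (.inr 0) (.inr 1))))))

/-- The definition of the representatives of rows. -/
def repFormulas : ℕ → orderedGraphSignature.lang.Formula (Fin 2)
  | 0 => relAtom 0 rfl (.inl 0) (.inl 1)
  | 1 => relAtom 1 rfl (.inl 0) (.inl 1)
  | _ => (relAtom 1 rfl (.inl 1) (.inl 0) ⊔ eqAtom (.inl 1) (.inl 0) :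
      orderedGraphSignature.lang.BoundedFormula (Fin 2) 0) ⊓
    .all ((relAtom 1 rfl (.inr 0) (.inl 1)).imp
      (.not (.all ((relAtom 1 rfl (.inl 0) (.inr 1)).imp
        ((relAtom 0 rfl (.inl 1) (.inr 1)).iff (relAtom 0 rfl (.inr 0) (.inr 1)))))))

/-- The removal of the first representatives. -/
def dropFormulas : ℕ → tripleSignature.lang.Formula (Fin 2)
  | 0 => relAtom 0 rfl (.inl 0) (.inl 1)
  | 1 => relAtom 1 rfl (.inl 0) (.inl 1)
  | _ => (relAtom 2 rfl (.inl 0) (.inl 1) : tripleSignature.lang.BoundedFormula (Fin 2) 0) ⊓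
    .ex (relAtom 1 rfl (.inr 0) (.inl 1) ⊓ relAtom 2 rfl (.inl 0) (.inr 0))

/-- The sentence that says that the third relation is empty. -/
def emptySentence : tripleSignature.lang.Sentence :=
  .all (.all ((relAtom 2 rfl (.inr 0) (.inr 1)).imp .falsum))

/-- The projection to the first two relations. -/
def projFormulas : ℕ → tripleSignature.lang.Formula (Fin 2)
  | 0 => relAtom 0 rfl (.inl 0) (.inl 1)
  | _ => relAtom 1 rfl (.inl 0) (.inl 1)

/-- The test whether there are at most `n` representatives of rows. -/
def testTransduction : ℕ → FOTransduction tripleSignature orderedGraphSignature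
  | 0 => .cons (.filtering emptySentence)
      (.cons (.interpretation _ (binFormulas eq_two_of_mem_ordered projFormulas)) .nil)
  | n + 1 => .cons (.interpretation _ (binFormulas eq_two_of_mem_triple dropFormulas))
      (testTransduction n)

/-- The transduction that outputs the orderings that are defined by the universal formula of depth
`d` and have at most `n` different rows at each cut. -/
noncomputable def orderTransduction (d n : ℕ) :
    FOTransduction graphSignature orderedGraphSignature :=
  .cons (.colouring (3 * nodeCount d))
    (.cons (.interpretation orderedGraphSignature
        (binFormulas eq_two_of_mem_ordered (orderFormulas (3 * nodeCount d) d)))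
      (.cons (.filtering linearSentence)
        (.cons (.interpretation _ (binFormulas eq_two_of_mem_triple repFormulas))
          (testTransduction n))))

section
open FirstOrder.Language.BoundedFormula (Realize realize_imp realize_inf realize_sup realize_iff
  realize_not realize_ex)
variable {V : Type u} {E lt C : V → V → Prop}

theorem realize_linearSentence :
    (binStructure eq_two_of_mem_ordered V (pairRel E lt)).α ⊨ linearSentence ↔
      IsStrictTotalOrder V lt := by
  have : (binStructure eq_two_of_mem_ordered V (pairRel E lt)).α ⊨ linearSentence ↔
      (∀ x, ¬ lt x x) ∧ (∀ x y z, lt x y → lt y z → lt x z) ∧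
        ∀ x y, ¬ lt x y → ¬ lt y x → x = y := by
    simp only [linearSentence, FirstOrder.Language.Sentence.Realize,
      FirstOrder.Language.Formula.Realize, realize_inf, Realize, realize_eqAtom, Sum.elim_inr]
    rfl
  rw [this]
  exact ⟨fun ⟨h1, h2, h3⟩ => { irrefl := h1, trans := h2, trichotomous := h3 },
    fun h => ⟨h.irrefl, h.trans, h.trichotomous⟩⟩

theorem realize_emptySentence :
    (binStructure eq_two_of_mem_triple V (tripleRel E lt C)).α ⊨ emptySentence ↔
      ∀ v x, ¬ C v x := by
  simp only [emptySentence, FirstOrder.Language.Sentence.Realize,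
    FirstOrder.Language.Formula.Realize, Realize]
  rfl

theorem outputs_rep :
    (FOOp.interpretation _ (binFormulas eq_two_of_mem_triple repFormulas)).outputs
        (binStructure eq_two_of_mem_ordered V (pairRel E lt)) =
      {binStructure eq_two_of_mem_triple V (tripleRel E lt (IsRep E lt))} := by
  rw [outputs_binFormulas]
  congr 2
  funext i a b
  refine propext ?_
  match i with
  | 0 => rfl
  | 1 => rfl
  | i + 2 =>
    simp only [repFormulas, FirstOrder.Language.Formula.Realize, realize_inf, realize_sup, Realize,
      realize_iff, realize_eqAtom, Sum.elim_inl]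
    rfl

theorem outputs_drop :
    (FOOp.interpretation _ (binFormulas eq_two_of_mem_triple dropFormulas)).outputs
        (binStructure eq_two_of_mem_triple V (tripleRel E lt C)) =
      {binStructure eq_two_of_mem_triple V (tripleRel E lt (dropFirst lt C 1))} := by
  rw [outputs_binFormulas]
  congr 2
  funext i a b
  refine propext ?_
  match i with
  | 0 => rfl
  | 1 => rfl
  | i + 2 =>
    simp only [dropFormulas, FirstOrder.Language.Formula.Realize, realize_inf, realize_ex]
    rfl

theorem outputs_proj :
    (FOOp.interpretation _ (binFormulas eq_two_of_mem_ordered projFormulas)).outputs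
        (binStructure eq_two_of_mem_triple V (tripleRel E lt C)) =
      {binStructure eq_two_of_mem_ordered V (pairRel E lt)} := by
  rw [outputs_binFormulas]
  congr 2
  funext i a b
  match i with
  | 0 => rfl
  | i + 1 => rfl

theorem dropFirst_dropFirst (n : ℕ) :
    dropFirst lt (dropFirst lt C 1) n = dropFirst lt C (n + 1) := by
  induction n with
  | zero => rfl
  | succ n ih =>
    funext v x
    simp only [dropFirst] at ih ⊢
    simp only [ih]

/-- Each removal is a separate interpretation, so the bound `n` enters as the length of the
transduction while all formulas stay fixed. -/
theorem mem_outputs_test {n : ℕ} {T : RelStructure.{u} orderedGraphSignature} :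
    T ∈ (testTransduction n).outputs
        (binStructure eq_two_of_mem_triple V (tripleRel E lt C)) ↔
      (∀ v x, ¬ dropFirst lt C n v x) ∧
        T = binStructure eq_two_of_mem_ordered V (pairRel E lt) := by
  induction n generalizing C with
  | zero =>
    simp only [testTransduction, FOTransduction.outputs, Set.mem_iUnion]
    constructor
    · rintro ⟨S, ⟨rfl, hS⟩, S', hS', hT⟩
      rw [outputs_proj] at hS'
      rw [Set.mem_singleton_iff.1 hS'] at hT
      exact ⟨realize_emptySentence.1 hS, hT⟩
    · rintro ⟨h, rfl⟩
      exact ⟨_, ⟨rfl, realize_emptySentence.2 h⟩, _, by rw [outputs_proj]; rfl, rfl⟩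
  | succ n ih =>
    simp only [testTransduction, FOTransduction.outputs, outputs_drop, Set.mem_iUnion,
      Set.mem_singleton_iff, exists_prop, exists_eq_left, ih, dropFirst_dropFirst]

/-- An exact description of the outputs on arbitrary, even infinite, digraphs. It yields the
extension property, soundness and completeness at once. -/
theorem mem_outputs_order {d n : ℕ} (G : Digraph V)
    {T : RelStructure.{u} orderedGraphSignature} :
    T ∈ (orderTransduction d n).outputs (graphStructure G) ↔
      ∃ lt : V → V → Prop, UDef G.Adj d lt ∧ IsStrictTotalOrder V lt ∧
        (∀ v x, ¬ dropFirst lt (IsRep G.Adj lt) n v x) ∧ T = orderedGraphStructure G lt := by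
  have hint : ∀ S : RelStructure.{u} (colSignature (3 * nodeCount d)),
      (FOOp.interpretation orderedGraphSignature
        (binFormulas eq_two_of_mem_ordered (orderFormulas (3 * nodeCount d) d))).outputs S =
      {binStructure eq_two_of_mem_ordered S.α
        (pairRel (colEdge S) (univRel (colEdge S) (colOf S) d 0))} := by
    intro S
    rw [outputs_binFormulas]
    congr 2
    funext i a b
    refine propext ?_
    match i with
    | 0 =>
      refine iff_of_eq (congrArg (S.str.RelMap _) (funext fun i => ?_))
      fin_cases i <;> rfl
    | i + 1 => exact realize_univFormula d 0 _ _ _ _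
  have h1 : ∀ S : RelStructure.{u} (colSignature (3 * nodeCount d)),
      S.IsExtensionOf (graphStructure G) → ∃ col : ℕ → V → Prop,
        binStructure eq_two_of_mem_ordered S.α
          (pairRel (colEdge S) (univRel (colEdge S) (colOf S) d 0)) =
        binStructure eq_two_of_mem_ordered V (pairRel G.Adj (univRel G.Adj col d 0)) := by
    rintro _ ⟨str, rfl, hstr⟩
    have hE : colEdge (⟨V, str⟩ : RelStructure.{u} (colSignature (3 * nodeCount d))) = G.Adj := by
      funext a b
      exact propext (hstr (⟨0, rfl⟩ : graphSignature.lang.Relations 2) ![a, b])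
    exact ⟨colOf (⟨V, str⟩ : RelStructure.{u} (colSignature (3 * nodeCount d))),
      congrArg (fun e => binStructure eq_two_of_mem_ordered V (pairRel e (univRel e _ d 0))) hE⟩
  have h2 : ∀ col : ℕ → V → Prop, ∃ S : RelStructure.{u} (colSignature (3 * nodeCount d)),
      S.IsExtensionOf (graphStructure G) ∧
        binStructure eq_two_of_mem_ordered S.α
          (pairRel (colEdge S) (univRel (colEdge S) (colOf S) d 0)) =
        binStructure eq_two_of_mem_ordered V (pairRel G.Adj (univRel G.Adj col d 0)) := by
    intro col
    let str : (colSignature (3 * nodeCount d)).lang.Structure V :=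
      { funMap := fun f => Empty.elim f
        RelMap := fun {r} R x => match R.1 with
          -- The symbol fixes its arity; the existential bounds merely make the arguments well-typed
          -- for every `r`.
          | 0 => ∃ h : 1 < r, G.Adj (x ⟨0, by omega⟩) (x ⟨1, h⟩)
          | j + 1 => ∃ h : 0 < r, col j (x ⟨0, h⟩) }
    refine ⟨⟨V, str⟩, ⟨str, rfl, ?_⟩, ?_⟩
    · rintro r ⟨_ | i, h⟩ x
      · obtain rfl : 2 = r := by simpa using h
        exact ⟨fun ⟨_, hx⟩ => hx, fun hx => ⟨Nat.one_lt_two, hx⟩⟩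
      · simp at h
    · have hE : colEdge (⟨V, str⟩ : RelStructure.{u} (colSignature (3 * nodeCount d))) =
          G.Adj := by
        funext a b
        exact propext ⟨fun ⟨_, hx⟩ => hx, fun hx => ⟨Nat.one_lt_two, hx⟩⟩
      rw [hE]
      have hlt : univRel G.Adj (colOf (⟨V, str⟩ : RelStructure.{u} _)) d 0 =
          univRel G.Adj col d 0 := by
        funext a b
        refine propext (univRel_congr d 0 0 (fun j hj v => ?_) a b)
        have hj' : (colSignature (3 * nodeCount d))[j + 1]? = some 1 := by simp [hj]
        simp only [Nat.mul_zero, Nat.zero_add]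
        exact ⟨fun ⟨_, _, h⟩ => h, fun h => ⟨hj', Nat.one_pos, h⟩⟩
      exact congrArg (fun e => binStructure eq_two_of_mem_ordered V (pairRel G.Adj e)) hlt
  simp only [orderTransduction, FOTransduction.outputs, hint, Set.mem_iUnion, exists_prop,
    Set.mem_singleton_iff, exists_eq_left]
  constructor
  · rintro ⟨S₁, hS₁, _, ⟨rfl, hlin⟩, S, hS, hT⟩
    obtain ⟨col, hcol⟩ := h1 S₁ hS₁
    rw [hcol] at hlin hS
    rw [outputs_rep, Set.mem_singleton_iff] at hS
    rw [hS, mem_outputs_test] at hT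
    exact ⟨_, ⟨col, fun _ _ => Iff.rfl⟩, realize_linearSentence.1 hlin, hT.1,
      hT.2.trans (orderedGraphStructure_eq G _).symm⟩
  · rintro ⟨lt, ⟨col, hcol⟩, hlin, hN, rfl⟩
    obtain rfl : lt = univRel G.Adj col d 0 := by
      funext a b
      exact propext (hcol a b)
    obtain ⟨S, hS, hSe⟩ := h2 col
    refine ⟨S, hS, _, ⟨rfl, ?_⟩, _, ?_, mem_outputs_test.2 ⟨hN, orderedGraphStructure_eq G _⟩⟩
    · rw [hSe]
      exact realize_linearSentence.2 hlin
    · rw [hSe, outputs_rep]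
      rfl

/-- Every structure over the signature of graphs is a graph. -/
theorem exists_eq_graphStructure (S : RelStructure.{u} graphSignature) :
    ∃ (V : Type u) (G : Digraph V), S = graphStructure G := by
  obtain ⟨V, str⟩ := S
  refine ⟨V, ⟨fun a b => str.RelMap (⟨0, rfl⟩ : graphSignature.lang.Relations 2) ![a, b]⟩, ?_⟩
  unfold graphStructure RelStructure.ofRel
  congr 1
  refine FirstOrder.Language.Structure.ext ?_ ?_
  · funext n f
    exact Empty.elim f
  · funext r R x
    obtain ⟨_ | i, h⟩ := R
    · obtain rfl : 2 = r := by simpa using h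
      refine congrArg (str.RelMap _) (funext fun i => ?_)
      fin_cases i <;> rfl
    · simp at h

theorem isExtension_order (d n : ℕ) : (orderTransduction d n).IsExtension := by
  intro S T hT
  obtain ⟨V, G, rfl⟩ := exists_eq_graphStructure S
  obtain ⟨lt, -, -, -, rfl⟩ := (mem_outputs_order G).1 hT
  refine ⟨(orderedGraphStructure G lt).str, rfl, ?_⟩
  rintro r ⟨_ | i, h⟩ x
  · rfl
  · simp at h

end

/-! ### Computability of the Gödel numbers -/

namespace Computable

variable {α : Type*} [Primcodable α] {f g : α → ℕ}

theorem natPair' (hf : Computable f) (hg : Computable g) :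
    Computable fun a => Nat.pair (f a) (g a) :=
  Primrec₂.natPair.to_comp.comp hf hg

theorem natAdd' (hf : Computable f) (hg : Computable g) : Computable fun a => f a + g a :=
  Primrec.nat_add.to_comp.comp hf hg

theorem natMul' (hf : Computable f) (hg : Computable g) : Computable fun a => f a * g a :=
  Primrec.nat_mul.to_comp.comp hf hg

/-- A recursion with five recursive calls on changed arguments is computable. -/
theorem of_five_calls {α : Type} [Denumerable α] {f : ℕ → α → ℕ}
    (h0 : Computable (f 0)) {y₁ y₂ y₃ y₄ y₅ : ℕ × α → α}
    (h₁ : Computable y₁) (h₂ : Computable y₂) (h₃ : Computable y₃) (h₄ : Computable y₄)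
    (h₅ : Computable y₅) {G : (ℕ × α) × ℕ × ℕ × ℕ × ℕ × ℕ → ℕ} (hG : Computable G)
    (hf : ∀ d x, f (d + 1) x = G ((d, x), f d (y₁ (d, x)), f d (y₂ (d, x)), f d (y₃ (d, x)),
      f d (y₄ (d, x)), f d (y₅ (d, x)))) :
    Computable₂ f := by
  have hpair : ∀ {β σ τ : Type} [Primcodable β] [Primcodable σ] [Primcodable τ] {P : β →. σ}
      {Q : β →. τ}, Partrec P → Partrec Q →
      Partrec fun a => (P a).bind fun r => (Q a).map fun s => (r, s) := fun hP hQ =>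
    hP.bind ((hQ.comp Computable.fst).map
      (Computable.pair (Computable.snd.comp Computable.fst) Computable.snd).to₂).to₂
  have hcall : ∀ {y : ℕ × α → α}, Computable y →
      Partrec fun p : Nat.Partrec.Code × ℕ × α =>
        p.1.eval (Encodable.encode (p.2.1, y p.2)) := fun hy =>
    Nat.Partrec.Code.eval_part.comp Computable.fst
      (Computable.encode.comp ((Computable.fst.comp Computable.snd).pair
        (hy.comp Computable.snd)))
  have hstep := (hpair (hcall h₁) (hpair (hcall h₂) (hpair (hcall h₃)
    (hpair (hcall h₄) (hcall h₅))))).map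
      (hG.comp ((Computable.snd.comp Computable.fst).pair Computable.snd)).to₂
  set stepFn : Nat.Partrec.Code × ℕ × α →. ℕ := _ with hstepFn
  have hstep' : Partrec stepFn := hstep
  have hF : Partrec₂ fun (c : Nat.Partrec.Code) (m : ℕ) =>
      ((Denumerable.ofNat (ℕ × α) m).1.casesOn
        (Part.some (f 0 (Denumerable.ofNat (ℕ × α) m).2))
        fun d => stepFn (c, d, (Denumerable.ofNat (ℕ × α) m).2) : Part ℕ) := by
    have ho : Computable fun p : Nat.Partrec.Code × ℕ => Denumerable.ofNat (ℕ × α) p.2 :=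
      (Primrec.ofNat _).to_comp.comp Computable.snd
    refine Partrec.nat_casesOn_right (Computable.fst.comp ho)
      (h0.comp (Computable.snd.comp ho)) ?_
    exact (hstep'.comp ((Computable.fst.comp Computable.fst).pair
      (Computable.snd.pair (Computable.snd.comp (ho.comp Computable.fst))))).to₂
  -- The recursive calls change the argument, so plain primitive recursion does not apply. Kleene's
  -- recursion theorem gives a program that calls itself, and induction on `d` shows that it halts
  -- with the right value.
  obtain ⟨c, hc⟩ := Nat.Partrec.Code.fixed_point₂ hF
  have hev : ∀ d x, c.eval (Encodable.encode (d, x)) = Part.some (f d x) := by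
    intro d
    induction d with
    | zero =>
      intro x
      rw [hc]
      simp
    | succ d ih =>
      intro x
      rw [hc]
      simp only [Encodable.encode_prod_val, Encodable.encode_nat] at ih
      simp [hstepFn, ih, hf]
  have : Partrec fun p : ℕ × α => c.eval (Encodable.encode p) :=
    Nat.Partrec.Code.eval_part.comp (Computable.const c) Computable.encode
  exact this.of_eq fun p => hev p.1 p.2

end Computable

/-! ### Gödel numbers of the transductions -/

/-- The Gödel number of an implication. -/
def impCode (a b : ℕ) : ℕ := Nat.pair 3 (Nat.pair a b)

/-- The Gödel number of a colour atom. -/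
def colCode (j a : ℕ) : ℕ := Nat.pair 2 (Nat.pair (j + 1) (Nat.pair a 0 + 1))

/-- The Gödel number of an edge atom. -/
def edgeCode (a b : ℕ) : ℕ := Nat.pair 2 (Nat.pair 0 (Nat.pair a (Nat.pair b 0 + 1) + 1))

/-- The Gödel number of the universal formula, from its depth, the number of its root, the number
of bound variables and the numbers of its arguments. -/
def univCode : ℕ → ℕ × ℕ × ℕ × ℕ → ℕ
  | 0, (o, _, a, b) =>
      impCode (impCode (colCode (3 * o) a) (impCode (edgeCode a b) 0))
        (impCode (impCode (colCode (3 * o + 1) a) (impCode (Nat.pair 1 (Nat.pair a b)) 0))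
          (colCode (3 * o + 2) a))
  | d + 1, (o, n, a, b) =>
      impCode (impCode (impCode (colCode (3 * o) a)
        (impCode (univCode d (o + 1, n, a, b)) (univCode d (o + 1 + nodeCount d, n, a, b))))
      (impCode (impCode (colCode (3 * o + 1) a)
        (Nat.pair 4 (impCode (univCode d (o + 1, n + 1, a, 2 * n + 1))
          (univCode d (o + 1 + nodeCount d, n + 1, 2 * n + 1, b)))))
      (impCode (impCode (colCode (3 * o + 2) a) (univCode d (o + 1, n, b, a))) 0))) 0

/-- The number of a variable. -/
def varCode {n : ℕ} (s : Fin 2 ⊕ Fin n) : ℕ := Sum.elim (fun i => 2 * i.1) (fun j => 2 * j.1 + 1) s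

theorem termCode_var {Γ : Signature} {n : ℕ} (s : Fin 2 ⊕ Fin n) :
    termCode (Γ := Γ) Fin.val (.var s) = varCode s := by
  rcases s with s | s <;> rfl

theorem formulaCode_colAtom {c j n : ℕ} (hj : j < c) (s : Fin 2 ⊕ Fin n) :
    formulaCode Fin.val (colAtom j s : (colSignature c).lang.BoundedFormula (Fin 2) n) =
      colCode j (varCode s) := by
  have h : (colSignature c)[j + 1]? = some 1 := by simp [hj]
  rw [colAtom, dif_pos h]
  simp [formulaCode, colCode, termCode_var]

theorem formulaCode_edge {c n : ℕ} (s t : Fin 2 ⊕ Fin n) :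
    formulaCode Fin.val (relAtom 0 rfl s t : (colSignature c).lang.BoundedFormula (Fin 2) n) =
      edgeCode (varCode s) (varCode t) := by
  simp [formulaCode, relAtom, edgeCode, termCode_var]

theorem varCode_map {n : ℕ} (s : Fin 2 ⊕ Fin n) : varCode (s.map id Fin.castSucc) = varCode s := by
  rcases s with s | s <;> rfl

/-- The bound on `c` says that all colours read below node `o` exist, so `colAtom` never falls back
to `falsum`. The new bound variable `Fin.last n` has the number `2 * n + 1`. -/
theorem formulaCode_univFormula {c : ℕ} (d : ℕ) : ∀ (o : ℕ) {n : ℕ} (s t : Fin 2 ⊕ Fin n),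
    3 * (o + nodeCount d) ≤ c →
      formulaCode Fin.val
        (univFormula d o s t : (colSignature c).lang.BoundedFormula (Fin 2) n) =
        univCode d (o, n, varCode s, varCode t) := by
  induction d with
  | zero =>
    intro o n s t h
    simp only [nodeCount] at h
    simp only [univFormula, formulaCode, univCode, formulaCode_colAtom (show 3 * o < c by omega),
      formulaCode_colAtom (show 3 * o + 1 < c by omega),
      formulaCode_colAtom (show 3 * o + 2 < c by omega), formulaCode_edge, eqAtom, termCode_var]
    rfl
  | succ d ih =>
    intro o n s t h
    simp only [nodeCount] at h
    simp only [univFormula, formulaCode, univCode, formulaCode_colAtom (show 3 * o < c by omega),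
      formulaCode_colAtom (show 3 * o + 1 < c by omega),
      formulaCode_colAtom (show 3 * o + 2 < c by omega),
      fun n (s t : Fin 2 ⊕ Fin n) => ih (o + 1) s t (by omega),
      fun n (s t : Fin 2 ⊕ Fin n) => ih (o + 1 + nodeCount d) s t (by omega), varCode_map]
    rfl

theorem computable_nodeCount : Computable nodeCount :=
  (Computable.nat_rec Computable.id (Computable.const 1)
    (h := fun _ p => 1 + 2 * p.2)
    ((Computable.const 1).natAdd' ((Computable.const 2).natMul'
      (Computable.snd.comp Computable.snd)))).of_eq fun d => by
    induction d with
    | zero => rfl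
    | succ d ih => exact congrArg (fun x => 1 + 2 * x) ih

section
variable {α : Type*} [Primcodable α] {f g : α → ℕ}

theorem Computable.impCode (hf : Computable f) (hg : Computable g) :
    Computable fun a => impCode (f a) (g a) :=
  (Computable.const 3).natPair' (hf.natPair' hg)

theorem Computable.colCode (hf : Computable f) (hg : Computable g) :
    Computable fun a => colCode (f a) (g a) :=
  (Computable.const 2).natPair' ((hf.natAdd' (Computable.const 1)).natPair'
    ((hg.natPair' (Computable.const 0)).natAdd' (Computable.const 1)))

theorem Computable.edgeCode (hf : Computable f) (hg : Computable g) :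
    Computable fun a => edgeCode (f a) (g a) :=
  (Computable.const 2).natPair' ((Computable.const 0).natPair'
    ((hf.natPair' ((hg.natPair' (Computable.const 0)).natAdd' (Computable.const 1))).natAdd'
      (Computable.const 1)))

end

theorem computable_univCode : Computable₂ univCode := by
  have c (k : ℕ) {β : Type} [Primcodable β] : Computable fun _ : β => k := Computable.const k
  have p1 : Computable fun x : ℕ × ℕ × ℕ × ℕ => x.1 := Computable.fst
  have p2 : Computable fun x : ℕ × ℕ × ℕ × ℕ => x.2.1 := Computable.fst.comp Computable.snd
  have p3 : Computable fun x : ℕ × ℕ × ℕ × ℕ => x.2.2.1 :=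
    Computable.fst.comp (Computable.snd.comp Computable.snd)
  have p4 : Computable fun x : ℕ × ℕ × ℕ × ℕ => x.2.2.2 :=
    Computable.snd.comp (Computable.snd.comp Computable.snd)
  have q1 : Computable fun x : ℕ × ℕ × ℕ × ℕ × ℕ => x.2.1 := p1.comp Computable.snd
  have q2 : Computable fun x : ℕ × ℕ × ℕ × ℕ × ℕ => x.2.2.1 := p2.comp Computable.snd
  have q3 : Computable fun x : ℕ × ℕ × ℕ × ℕ × ℕ => x.2.2.2.1 := p3.comp Computable.snd
  have q4 : Computable fun x : ℕ × ℕ × ℕ × ℕ × ℕ => x.2.2.2.2 := p4.comp Computable.snd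
  have l : Computable fun x : ℕ × ℕ × ℕ × ℕ × ℕ => x.2.1 + 1 := q1.natAdd' (c 1)
  have r : Computable fun x : ℕ × ℕ × ℕ × ℕ × ℕ => x.2.1 + 1 + nodeCount x.1 :=
    l.natAdd' (computable_nodeCount.comp Computable.fst)
  have z : Computable fun x : ℕ × ℕ × ℕ × ℕ × ℕ => 2 * x.2.2.1 + 1 :=
    ((c 2).natMul' q2).natAdd' (c 1)
  have n' := q2.natAdd' (c 1)
  let Q := (ℕ × ℕ × ℕ × ℕ × ℕ) × ℕ × ℕ × ℕ × ℕ × ℕ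
  have r0 : Computable fun x : Q => x.2 := Computable.snd
  have r1 : Computable fun x : Q => x.2.1 := Computable.fst.comp r0
  have r2' : Computable fun x : Q => x.2.2 := Computable.snd.comp r0
  have r2 : Computable fun x : Q => x.2.2.1 := Computable.fst.comp r2'
  have r3' : Computable fun x : Q => x.2.2.2 := Computable.snd.comp r2'
  have r3 : Computable fun x : Q => x.2.2.2.1 := Computable.fst.comp r3'
  have r4' : Computable fun x : Q => x.2.2.2.2 := Computable.snd.comp r3'
  have r4 : Computable fun x : Q => x.2.2.2.2.1 := Computable.fst.comp r4'
  have r5 : Computable fun x : Q => x.2.2.2.2.2 := Computable.snd.comp r4'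
  have o : Computable fun x : Q => x.1.2.1 := q1.comp Computable.fst
  have a : Computable fun x : Q => x.1.2.2.2.1 := q3.comp Computable.fst
  exact Computable.of_five_calls
    (Computable.impCode (Computable.impCode (Computable.colCode ((c 3).natMul' p1) p3)
        (Computable.impCode (Computable.edgeCode p3 p4) (c 0)))
      (Computable.impCode (Computable.impCode
          (Computable.colCode (((c 3).natMul' p1).natAdd' (c 1)) p3)
          (Computable.impCode ((c 1).natPair' (p3.natPair' p4)) (c 0)))
        (Computable.colCode (((c 3).natMul' p1).natAdd' (c 2)) p3)))
    -- The arguments of the five calls: both sides of the implication, both sides of the composition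
    -- through the new variable, and the converse.
    (l.pair (q2.pair (q3.pair q4))) (r.pair (q2.pair (q3.pair q4)))
    (l.pair (n'.pair (q3.pair z))) (r.pair (n'.pair (z.pair q4)))
    (l.pair (q2.pair (q4.pair q3)))
    (Computable.impCode (Computable.impCode (Computable.impCode
        (Computable.colCode ((c 3).natMul' o) a) (Computable.impCode r1 r2))
      (Computable.impCode (Computable.impCode
          (Computable.colCode (((c 3).natMul' o).natAdd' (c 1)) a)
          ((c 4).natPair' (Computable.impCode r3 r4)))
        (Computable.impCode (Computable.impCode
          (Computable.colCode (((c 3).natMul' o).natAdd' (c 2)) a) r5) (c 0)))) (c 0))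
    fun d x => rfl

theorem computable_testTransduction_code : Computable fun n => (testTransduction n).code :=
  (Computable.nat_rec Computable.id (Computable.const (testTransduction 0).code)
    (h := fun _ p => Nat.pair (FOOp.interpretation tripleSignature
      (binFormulas eq_two_of_mem_triple dropFormulas)).code p.2 + 1)
    (((Computable.const _).natPair' (Computable.snd.comp Computable.snd)).natAdd'
      (Computable.const 1))).of_eq fun n => by
    induction n with
    | zero => rfl
    | succ n ih => exact congrArg (fun x => Nat.pair _ x + 1) ih

/-- Only the colour count, `univCode` and the test vary with `d` and `n`; everything else is
constant. The two free variables have the numbers 0 and 2. -/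
theorem orderTransduction_code (d n : ℕ) : (orderTransduction d n).code =
    Nat.pair (Nat.pair 1 (3 * nodeCount d)) (Nat.pair
      (Nat.pair 0 (Nat.pair (Encodable.encode orderedGraphSignature)
        (Nat.pair (edgeCode 0 2) (Nat.pair (univCode d (0, 0, 0, 2)) 0 + 1) + 1)))
      (Nat.pair (FOOp.filtering linearSentence).code (Nat.pair
        (FOOp.interpretation tripleSignature
          (binFormulas eq_two_of_mem_triple repFormulas)).code
        (testTransduction n).code + 1) + 1) + 1) + 1 := by
  have h1 := formulaCode_univFormula (c := 3 * nodeCount d) d 0 (n := 0) (.inl 0) (.inl 1) (by simp)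
  have h2 := formulaCode_edge (c := 3 * nodeCount d) (n := 0) (.inl 0) (.inl 1)
  have h3 : (FOOp.interpretation orderedGraphSignature
      (binFormulas eq_two_of_mem_ordered (orderFormulas (3 * nodeCount d) d))).code =
      Nat.pair 0 (Nat.pair (Encodable.encode orderedGraphSignature)
        (Encodable.encode [formulaCode Fin.val (orderFormulas (3 * nodeCount d) d 0),
          formulaCode Fin.val (orderFormulas (3 * nodeCount d) d 1)])) := rfl
  have h4 : formulaCode Fin.val (orderFormulas (3 * nodeCount d) d 0) = edgeCode 0 2 := h2
  have h5 : formulaCode Fin.val (orderFormulas (3 * nodeCount d) d 1) =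
    univCode d (0, 0, 0, 2) := h1
  rw [h4, h5] at h3
  simp only [orderTransduction, FOTransduction.code, h3]
  rfl

theorem computable_orderTransduction_code {f g : ℕ → ℕ} (hf : Computable f) (hg : Computable g) :
    Computable fun k => (orderTransduction (f k) (g k)).code := by
  have c (k : ℕ) : Computable fun _ : ℕ => k := Computable.const k
  simp only [orderTransduction_code]
  exact (((c 1).natPair' ((c 3).natMul' (computable_nodeCount.comp hf))).natPair' ((((c 0).natPair'
    ((c _).natPair' (((c _).natPair' (((computable_univCode.comp hf (Computable.const _)).natPair'
      (c 0)).natAdd' (c 1))).natAdd' (c 1)))).natPair' (((c _).natPair' (((c _).natPair'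
        (computable_testTransduction_code.comp hg)).natAdd' (c 1))).natAdd' (c 1))).natAdd'
          (c 1))).natAdd' (c 1)

theorem computable_two_pow : Computable fun k => 2 ^ k :=
  (Computable.nat_rec Computable.id (Computable.const 1) (h := fun _ p => p.2 * 2)
    ((Computable.snd.comp Computable.snd).natMul' (Computable.const 2))).of_eq fun k => by
    induction k with
    | zero => rfl
    | succ k ih => exact (congrArg (· * 2) ih).trans (pow_succ 2 k).symm

theorem computable_depthBound : Computable₂ depthBound := by
  have c (k : ℕ) {β : Type} [Primcodable β] : Computable fun _ : β => k := Computable.const k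
  have hK : Computable fun p : (ℕ × ℕ) × ℕ × ℕ => p.1.1 := Computable.fst.comp Computable.fst
  have hI : Computable fun p : (ℕ × ℕ) × ℕ × ℕ => p.2.2 := Computable.snd.comp Computable.snd
  refine (Computable.nat_rec (f := fun p : ℕ × ℕ => p.2) (g := fun _ => 0)
    (h := fun p q => 14 * (p.1 * 2 ^ p.1 * 3) + 4 * q.2 + 60) Computable.snd (c 0)
    ((((c 14).natMul' ((hK.natMul' (computable_two_pow.comp hK)).natMul' (c 3))).natAdd'
      ((c 4).natMul' hI)).natAdd' (c 60))).of_eq ?_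
  rintro ⟨K, m⟩
  induction m with
  | zero => rfl
  | succ m ih => exact congrArg (fun x => 14 * (K * 2 ^ K * 3) + 4 * x + 60) ih

theorem computable_rowBound : Computable₂ rowBound := by
  have c (k : ℕ) {β : Type} [Primcodable β] : Computable fun _ : β => k := Computable.const k
  have hK : Computable fun p : (ℕ × ℕ) × ℕ × ℕ => p.1.1 := Computable.fst.comp Computable.fst
  have hI : Computable fun p : (ℕ × ℕ) × ℕ × ℕ => p.2.2 := Computable.snd.comp Computable.snd
  have hP := hK.natMul' (computable_two_pow.comp hK)
  refine (Computable.nat_rec (f := fun p : ℕ × ℕ => p.2) (g := fun _ => 1)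
    (h := fun p q => p.1 * 2 ^ p.1 * 3 * (1 + p.1 * 2 ^ p.1 * (1 + q.2))) Computable.snd (c 1)
    ((hP.natMul' (c 3)).natMul' ((c 1).natAdd' (hP.natMul' ((c 1).natAdd' hI))))).of_eq ?_
  rintro ⟨K, m⟩
  induction m with
  | zero => rfl
  | succ m ih => exact congrArg (fun x => K * 2 ^ K * 3 * (1 + K * 2 ^ K * (1 + x))) ih

theorem mainTheorem3 :
    ∃ (Φ : ℕ → FOTransduction graphSignature orderedGraphSignature) (k' : ℕ → ℕ),
      Computable (fun k => (Φ k).code) ∧ Computable k' ∧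
      ∀ k : ℕ,
        FOTransduction.IsExtension.{u} (Φ k) ∧
        (∀ (V : Type u) [Fintype V] (G : Digraph V),
          ∀ S ∈ (Φ k).outputs (graphStructure G),
            ∃ lt : V → V → Prop, IsStrictTotalOrder V lt ∧ cutRank G lt ≤ k' k ∧
              S = orderedGraphStructure G lt) ∧
        (∀ (V : Type u) [Fintype V] (T : Digraph V),
          IsTournament T → linearNLCWidth T ≤ k →
            ∃ lt : V → V → Prop, IsStrictTotalOrder V lt ∧ cutRank T lt ≤ k' k ∧
              orderedGraphStructure T lt ∈ (Φ k).outputs (graphStructure T)) := by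
  have hd : Computable fun k => depthBound (k + 1) (k + 1) :=
    computable_depthBound.comp Computable.succ Computable.succ
  have hr : Computable fun k => rowBound (k + 1) (k + 1) :=
    computable_rowBound.comp Computable.succ Computable.succ
  refine ⟨fun k => orderTransduction (depthBound (k + 1) (k + 1)) (rowBound (k + 1) (k + 1)),
    fun k => rowBound (k + 1) (k + 1), computable_orderTransduction_code hd hr, hr, fun k =>
    ⟨isExtension_order _ _, fun V _ G S hS => ?_, fun V _ T hT hk => ?_⟩⟩
  · obtain ⟨lt, -, hlt, hN, rfl⟩ := (mem_outputs_order G).1 hS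
    exact ⟨lt, hlt, cutRank_le G hN, rfl⟩
  · obtain ⟨lt, hdef, hlt, hcut⟩ := hT.hasDefinableOrder hk
    have hN := fun v => not_dropFirst (lt := lt) (hcut.ncard_isRep_le v)
    exact ⟨lt, hlt, cutRank_le T hN, (mem_outputs_order T).2 ⟨lt, hdef, hlt, hN, rfl⟩⟩
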